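/- Let $n\ge 1$ and $[n]=\{1,\dots,n\}$. **Relations and reductions.** Consider noncommutative polynomials over $\mathbb{Q}$ in variables $x_{ij},y_{ij}$ ($i\neq j$) and $z_i$ ($i,j\in[n]$). The bracket algebra $\mathcal{B}(C_n)$ is defined by the following relations. (1) $x_{ij}=-x_{ji}$, $y_{ij}=y_{ji}$ for $i\ne j$; (2) $z_iz_j=z_jz_i$; (3) $x_{ij}x_{kl}=x_{kl}x_{ij}$, $y_{ij}x_{kl}=x_{kl}y_{ij}$, $y_{ij}y_{kl}=y_{kl}y_{ij}$ for $i<j$, $k<l$ with $i,j,k,l$ distinct; (4) $z_ix_{kl}=x_{kl}z_i$, $z_iy_{kl}=y_{kl}z_i$ for $i\ne k,l$; and the relations obtained by reading the following reductions as equalities, where $1\le i<j<k\le n$ (in the last line $1\le i<j\le n$): $x_{ij}x_{jk}\to x_{ik}x_{ij}+x_{jk}x_{ik}$, $\quad x_{jk}x_{ij}\to x_{ij}x_{ik}+x_{ik}x_{jk}$, $x_{ij}y_{jk}\to y_{ik}x_{ij}+y_{jk}y_{ik}$, $\quad y_{jk}x_{ij}\to x_{ij}y_{ik}+y_{ik}y_{jk}$,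 $x_{ik}y_{jk}\to y_{jk}y_{ij}+y_{ij}x_{ik}$, $\quad y_{jk}x_{ik}\to y_{ij}y_{jk}+x_{ik}y_{ij}$, $y_{ik}x_{jk}\to x_{jk}y_{ij}+y_{ij}y_{ik}$, $\quad x_{jk}y_{ik}\to y_{ij}x_{jk}+y_{ik}y_{ij}$, $x_{ij}z_j\to z_ix_{ij}+y_{ij}z_i+z_jy_{ij}$, $\quad z_jx_{ij}\to x_{ij}z_i+z_iy_{ij}+y_{ij}z_j$. A *reduced form* of a monomial $m$ is a polynomial obtained from $m$ by successively applying, in any order, the relations (1)–(4) and the reductions to terms (or parts of terms) of the polynomial, to which no reduction can be applied any more, even after using (1)–(4). *Up to commutations* means: modulo the relations (1)–(4) only; for two monomials in the variables $x_{ij},y_{ij}$ ($i<j$), $z_i$ it means that one is obtained from the other by the commutations (2)–(4). A *$\mathcal{B}$-reduction tree* with root $m$ is a finite tree of monomials with root $m$ in which the children of an inner node $m'$ are the two or three monomials produced by applying one reduction to two adjacent variables of $m'$, possibly after commutations (2)–(4), and in which no reduction can be applied to a leaf, even after commutations (2)–(4). **Graphs.** A signed graph on $[n]$ has edges $(i,j,\epsilon)=(j,i,\epsilon)$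 with $\epsilon\in\{+,-\}$; all loops are positive. A positive edge is incident with sign $+$ to its endpoints; a negative edge is incident with sign $+$ to its smaller and with sign $-$ to its greater endpoint. The graph is *alternating* if at each vertex all incident edges are incident with the same sign. A graph $H$ is *well-structured* if (i) there are no edges $(i,k,\epsilon_1),(j,l,\epsilon_2)$ with $i<j<k<l$; (ii) for edges $(i,j,+),(k,l,+)$ with $i<j$, $k<l$: $i<l$ and $k<j$; (iii) for edges $(i,i,+),(k,l,+)$ with $k<l$: $k\le i\le l$; (iv) there are no edges $(i,i,+),(k,j,-)$ with $k<i<j$; (v) there are no edges $(i,j,+),(k,l,-)$ with $k\le i<j\le l$; (vi) $H$ is connected, has exactly one loop, and has no nonloop cycle. In the *lexicographic order* on edges every positive edge precedes every negative edge, and among edges of the same sign, written with $i_1\le j_1$, $i_2\le j_2$, $(i_1,j_1,\epsilon)$ precedes $(i_2,j_2,\epsilon)$ if $j_1>j_2$, or $j_1=j_2$ and $i_1>i_2$. For a well-structured graph $T^l$ with lexicographic edge-labels, $m^{\mathcal{B}}[T^l]$ is the product, in increasing lexicographic order of the edges, of the variables $x_{ij}$ for $(i,j,-)$, $y_{ij}$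 for $(i,j,+)$ ($i<j$) and $z_i$ for the loop $(i,i,+)$. **Theorem.** Let $w_{C_n}=x_{12}x_{23}\cdots x_{n-1,n}z_n$. Then $w_{C_n}$ has a reduced form, and every reduced form $P^{\mathcal{B}}_n$ of $w_{C_n}$ satisfies, up to commutations, $$P^{\mathcal{B}}_n=\sum_{T^l}m^{\mathcal{B}}[T^l],$$ where the sum runs over all alternating well-structured graphs $T^l$ on $[n]$ with lexicographic edge-labels. In particular, up to commutations, the reduced form does not depend on the order of the reductions. Moreover, $\mathcal{B}$-reduction trees with root $w_{C_n}$ exist, and the leaves of any such tree are, up to commutations, exactly the monomials $m^{\mathcal{B}}[T^l]$ of all these graphs, each graph occurring exactly once. -/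

import Mathlib

namespace BracketC

/-! ### Noncommutative polynomials in the variables `x_ij`, `y_ij`, `z_i` -/

/-- The variables `x_ij`, `y_ij` (`i ≠ j`) and `z_i` of the bracket algebra of type `C_n`;
the index set `[n]` is `Fin n`. -/
inductive Gen (n : ℕ) : Type
  | x (i j : Fin n) (h : i ≠ j) : Gen n
  | y (i j : Fin n) (h : i ≠ j) : Gen n
  | z (i : Fin n) : Gen n

/-- Noncommutative polynomials over `ℚ` in the variables `x_ij`, `y_ij`, `z_i`
(the free associative algebra, with its basis of words). -/
abbrev NCPoly (n : ℕ) : Type := MonoidAlgebra ℚ (FreeMonoid (Gen n))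

/-- The monomial given by a word in the variables. -/
noncomputable def mon {n : ℕ} (w : List (Gen n)) : NCPoly n :=
  MonoidAlgebra.single (FreeMonoid.ofList w) 1

/-- The coefficient of the monomial `w` in the polynomial `P`. -/
def coeffAt {n : ℕ} (P : NCPoly n) (w : List (Gen n)) : ℚ :=
  P.coeff (FreeMonoid.ofList w)

/-! ### The relations of the bracket algebra -/

/-- The commutations `ab = ba` of the bracket algebra: `z_i z_j = z_j z_i`; variables
`x_ij, y_kl` etc. with four distinct indices; `z_i` with `x_kl`, `y_kl` for `i ≠ k, l`. -/
inductive Commute₂ {n : ℕ} : Gen n → Gen n → Prop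
  | zz (i j : Fin n) : Commute₂ (.z i) (.z j)
  | xx {i j k l : Fin n} (hij : i < j) (hkl : k < l)
      (h : i ≠ k ∧ i ≠ l ∧ j ≠ k ∧ j ≠ l) : Commute₂ (.x i j hij.ne) (.x k l hkl.ne)
  | yx {i j k l : Fin n} (hij : i < j) (hkl : k < l)
      (h : i ≠ k ∧ i ≠ l ∧ j ≠ k ∧ j ≠ l) : Commute₂ (.y i j hij.ne) (.x k l hkl.ne)
  | yy {i j k l : Fin n} (hij : i < j) (hkl : k < l)
      (h : i ≠ k ∧ i ≠ l ∧ j ≠ k ∧ j ≠ l) : Commute₂ (.y i j hij.ne) (.y k l hkl.ne)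
  | zx {i k l : Fin n} (hkl : k ≠ l) (h : i ≠ k ∧ i ≠ l) : Commute₂ (.z i) (.x k l hkl)
  | zy {i k l : Fin n} (hkl : k ≠ l) (h : i ≠ k ∧ i ≠ l) : Commute₂ (.z i) (.y k l hkl)

/-- The non-reducing relations, read as replacements of a word by a polynomial:
`x_ij = -x_ji`, `y_ij = y_ji`, and the commutations, in both directions. -/
inductive StructuralRule {n : ℕ} : List (Gen n) → NCPoly n → Prop
  | xflip (i j : Fin n) (h : i ≠ j) : StructuralRule [.x i j h] (-mon [.x j i h.symm])
  | yflip (i j : Fin n) (h : i ≠ j) : StructuralRule [.y i j h] (mon [.y j i h.symm])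
  | swap {a b : Gen n} (h : Commute₂ a b ∨ Commute₂ b a) : StructuralRule [a, b] (mon [b, a])

/-- `ReductionRule a b rs`: the reduction `ab → ∑ rs` of the bracket algebra, where `rs` lists
the words on the right-hand side. -/
inductive ReductionRule {n : ℕ} : Gen n → Gen n → List (List (Gen n)) → Prop
  | xx {i j k : Fin n} (h : i < j) (h' : j < k) :
      ReductionRule (.x i j h.ne) (.x j k h'.ne)
        [[.x i k (h.trans h').ne, .x i j h.ne], [.x j k h'.ne, .x i k (h.trans h').ne]]
  | xx' {i j k : Fin n} (h : i < j) (h' : j < k) :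
      ReductionRule (.x j k h'.ne) (.x i j h.ne)
        [[.x i j h.ne, .x i k (h.trans h').ne], [.x i k (h.trans h').ne, .x j k h'.ne]]
  | xy {i j k : Fin n} (h : i < j) (h' : j < k) :
      ReductionRule (.x i j h.ne) (.y j k h'.ne)
        [[.y i k (h.trans h').ne, .x i j h.ne], [.y j k h'.ne, .y i k (h.trans h').ne]]
  | xy' {i j k : Fin n} (h : i < j) (h' : j < k) :
      ReductionRule (.y j k h'.ne) (.x i j h.ne)
        [[.x i j h.ne, .y i k (h.trans h').ne], [.y i k (h.trans h').ne, .y j k h'.ne]]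
  | xyMax {i j k : Fin n} (h : i < j) (h' : j < k) :
      ReductionRule (.x i k (h.trans h').ne) (.y j k h'.ne)
        [[.y j k h'.ne, .y i j h.ne], [.y i j h.ne, .x i k (h.trans h').ne]]
  | xyMax' {i j k : Fin n} (h : i < j) (h' : j < k) :
      ReductionRule (.y j k h'.ne) (.x i k (h.trans h').ne)
        [[.y i j h.ne, .y j k h'.ne], [.x i k (h.trans h').ne, .y i j h.ne]]
  | yxMax {i j k : Fin n} (h : i < j) (h' : j < k) :
      ReductionRule (.y i k (h.trans h').ne) (.x j k h'.ne)
        [[.x j k h'.ne, .y i j h.ne], [.y i j h.ne, .y i k (h.trans h').ne]]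
  | yxMax' {i j k : Fin n} (h : i < j) (h' : j < k) :
      ReductionRule (.x j k h'.ne) (.y i k (h.trans h').ne)
        [[.y i j h.ne, .x j k h'.ne], [.y i k (h.trans h').ne, .y i j h.ne]]
  | xz {i j : Fin n} (h : i < j) :
      ReductionRule (.x i j h.ne) (.z j)
        [[.z i, .x i j h.ne], [.y i j h.ne, .z i], [.z j, .y i j h.ne]]
  | xz' {i j : Fin n} (h : i < j) :
      ReductionRule (.z j) (.x i j h.ne)
        [[.x i j h.ne, .z i], [.z i, .y i j h.ne], [.y i j h.ne, .z j]]

/-- The reductions, read as replacements of a word by a polynomial. -/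
def BracketRule {n : ℕ} (l : List (Gen n)) (r : NCPoly n) : Prop :=
  ∃ a b rs, ReductionRule a b rs ∧ l = [a, b] ∧ r = (rs.map mon).sum

/-! ### Reduced forms -/

/-- One application of a rule `l → r` of the family `R` to a polynomial `P`: in a term
`c • u l v` of `P`, or in a part `t c • u l v` of that term (`0 < t ≤ 1`), the factor `l` is
replaced by `r`. Allowing a part of a term allows equal monomials that arose in different ways
to be treated differently. -/
def Rewrites {n : ℕ} (R : List (Gen n) → NCPoly n → Prop) (P Q : NCPoly n) : Prop :=
  ∃ (u l v : List (Gen n)) (r : NCPoly n) (t : ℚ), R l r ∧ 0 < t ∧ t ≤ 1 ∧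
    coeffAt P (u ++ l ++ v) ≠ 0 ∧
    Q = P + (t * coeffAt P (u ++ l ++ v)) • (mon u * r * mon v - mon (u ++ l ++ v))

/-- No reduction can be applied to `P`, even after changing `P` by the structural rules. -/
def IsIrreducible {n : ℕ} (P : NCPoly n) : Prop :=
  ∀ Q, Relation.ReflTransGen (Rewrites StructuralRule) P Q → ∀ Q', ¬ Rewrites BracketRule Q Q'

/-- `P` is a reduced form of the monomial `w`: it is obtained from `w` by successive application
of the relations, in any order, and no further reduction is possible. -/
def IsReducedForm {n : ℕ} (w : List (Gen n)) (P : NCPoly n) : Prop :=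
  Relation.ReflTransGen (fun P Q => Rewrites StructuralRule P Q ∨ Rewrites BracketRule P Q)
    (mon w) P ∧ IsIrreducible P

/-- The identifications made by the structural rules. -/
def structuralRel (n : ℕ) (p q : NCPoly n) : Prop :=
  ∃ l, p = mon l ∧ StructuralRule l q

/-- Noncommutative polynomials up to `x_ij = -x_ji`, `y_ij = y_ji` and the allowed commutations.
The reducing relations are not imposed here. -/
abbrev PartComm (n : ℕ) : Type := RingQuot (structuralRel n)

/-- The class of a polynomial up to the allowed commutations. -/
noncomputable def upToComm {n : ℕ} : NCPoly n →ₐ[ℚ] PartComm n :=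
  RingQuot.mkAlgHom ℚ (structuralRel n)

/-! ### Reduction trees

A monomial is the same thing as a graph with edges labeled `1, 2, …`; the label of an edge is its
position in the word. -/

/-- Exchange of two adjacent commuting letters. -/
def SwapStep {n : ℕ} (w w' : List (Gen n)) : Prop :=
  ∃ u a b v, (Commute₂ a b ∨ Commute₂ b a) ∧ w = u ++ [a, b] ++ v ∧ w' = u ++ [b, a] ++ v

/-- Equality of monomials up to the allowed commutations. -/
def CommEquiv {n : ℕ} : List (Gen n) → List (Gen n) → Prop :=
  Relation.ReflTransGen SwapStep

/-- `HasLeaves w L`: there is a reduction tree with root `w` whose leaves, with multiplicity, are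
`L`. Commutations are allowed before a reduction, and are not recorded in the tree; a node is a
leaf only if no reduction applies to it after any commutations. -/
inductive HasLeaves {n : ℕ} : List (Gen n) → Multiset (List (Gen n)) → Prop
  | leaf (w : List (Gen n))
      (h : ∀ u a b v rs, CommEquiv w (u ++ [a, b] ++ v) → ¬ ReductionRule a b rs) :
      HasLeaves w {w}
  | node (w u v : List (Gen n)) (a b : Gen n) (rs : List (List (Gen n)))
      (L : List (Gen n) → Multiset (List (Gen n)))
      (hw : CommEquiv w (u ++ [a, b] ++ v)) (hr : ReductionRule a b rs)
      (hL : ∀ r ∈ rs, HasLeaves (u ++ r ++ v) (L r)) :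
      HasLeaves w (rs.map L).sum

/-- The Coxeter type element `x_{12} x_{23} ⋯ x_{n-1,n} z_n`. -/
def coxeterWord (n : ℕ) (hn : 1 ≤ n) : List (Gen n) :=
  (List.finRange (n - 1)).map
      (fun (i : Fin (n - 1)) =>
        Gen.x ⟨i, by omega⟩ ⟨i + 1, by omega⟩ (by simp [Fin.ext_iff])) ++
    [Gen.z ⟨n - 1, by omega⟩]

/-! ### Signed graphs -/

/-- An edge `(i, j, ε)`; the sign `ε` is `true` for `+` and `false` for `-`. -/
abbrev Edge (n : ℕ) : Type := Fin n × Fin n × Bool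

/-- The sign `+`. -/
abbrev plus : Bool := true

/-- The sign `-`. -/
abbrev minus : Bool := false

/-- `G` is the edge set of a signed graph on `[n]`: since `(i, j, ε) = (j, i, ε)`, every edge is
written with its smaller endpoint first, and loops are positive. (The graphs considered below have
no repeated edges, so an edge set suffices.) -/
def IsSignedGraph {n : ℕ} (G : Finset (Edge n)) : Prop :=
  (∀ i j ε, (i, j, ε) ∈ G → i ≤ j) ∧ (∀ i ε, (i, i, ε) ∈ G → ε = plus)

/-- The simple graph on `[n]` obtained by forgetting loops and signs. -/
def skeleton {n : ℕ} (G : Finset (Edge n)) : SimpleGraph (Fin n) :=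
  SimpleGraph.fromRel (fun i j => ∃ ε, (i, j, ε) ∈ G)

/-- Well-structured graphs. -/
structure WellStructured {n : ℕ} (G : Finset (Edge n)) : Prop where
  signed : IsSignedGraph G
  noncrossing : ∀ i j k l ε₁ ε₂, i < j → j < k → k < l →
    ¬ ((i, k, ε₁) ∈ G ∧ (j, l, ε₂) ∈ G)
  pos_pos : ∀ i j k l, (i, j, plus) ∈ G → (k, l, plus) ∈ G → i < j → k < l → i < l ∧ k < j
  loop_pos : ∀ i k l, (i, i, plus) ∈ G → (k, l, plus) ∈ G → k < l → k ≤ i ∧ i ≤ l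
  loop_neg : ∀ i k j, k < i → i < j → ¬ ((i, i, plus) ∈ G ∧ (k, j, minus) ∈ G)
  pos_neg : ∀ i j k l, k ≤ i → i < j → j ≤ l → ¬ ((i, j, plus) ∈ G ∧ (k, l, minus) ∈ G)
  connected : (skeleton G).Connected
  one_loop : ∃! i, (i, i, plus) ∈ G
  /-- no nonloop cycle of length two -/
  no_two_cycle : ∀ i j, i < j → ¬ ((i, j, plus) ∈ G ∧ (i, j, minus) ∈ G)
  /-- no nonloop cycle of length at least three -/
  acyclic : (skeleton G).IsAcyclic

/-- The sign with which the edge `e` is incident to its endpoint `v`: a positive edge is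
positively incident to both endpoints, a negative edge is positively incident to its smaller
endpoint and negatively incident to its greater endpoint. -/
def incSign {n : ℕ} (e : Edge n) (v : Fin n) : Bool :=
  if e.2.2 = plus then plus else if v = e.1 then plus else minus

/-- A graph is alternating if at every vertex `v` all edges incident to `v` are incident to `v`
with the same sign. -/
def Alternating {n : ℕ} (G : Finset (Edge n)) : Prop :=
  ∀ v, ∀ e ∈ G, ∀ f ∈ G, (v = e.1 ∨ v = e.2.1) → (v = f.1 ∨ v = f.2.1) → incSign e v = incSign f v

open Classical in
/-- The set of all alternating well-structured graphs on `[n]`. -/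
noncomputable def altWellStructured (n : ℕ) : Finset (Finset (Edge n)) :=
  Finset.univ.filter (fun G => WellStructured G ∧ Alternating G)

/-- The lexicographic order on edges: positive edges come before negative edges, and among edges
of the same sign, `(i₁, j₁)` is before `(i₂, j₂)` if `j₁ > j₂`, or `j₁ = j₂` and `i₁ > i₂`. -/
def LexLE {n : ℕ} (e f : Edge n) : Prop :=
  (e.2.2 = plus ∧ f.2.2 = minus) ∨
    (e.2.2 = f.2.2 ∧ (e.2.1 > f.2.1 ∨ (e.2.1 = f.2.1 ∧ e.1 ≥ f.1)))

instance {n : ℕ} : DecidableRel (@LexLE n) := fun e f => by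
  unfold LexLE; infer_instance

instance {n : ℕ} : IsTrans (Edge n) LexLE := ⟨by
  rintro ⟨i, j, a⟩ ⟨k, l, b⟩ ⟨p, q, c⟩
  cases a <;> cases b <;> cases c <;> simp [LexLE, plus, minus] <;> omega⟩

instance {n : ℕ} : Std.Antisymm (@LexLE n) := ⟨by
  rintro ⟨i, j, a⟩ ⟨k, l, b⟩
  cases a <;> cases b <;> simp [LexLE, plus, minus] <;> omega⟩

instance {n : ℕ} : Std.Total (@LexLE n) := ⟨by
  rintro ⟨i, j, a⟩ ⟨k, l, b⟩
  cases a <;> cases b <;> simp [LexLE, plus, minus] <;> omega⟩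

/-- The variable of an edge: `z_i` for the loop at `i`, `y_ij` for a positive edge and `x_ij` for
a negative edge with endpoints `i < j`. -/
def edgeVar {n : ℕ} (e : Edge n) : Gen n :=
  if h : e.1 = e.2.1 then .z e.1
  else if e.2.2 = plus then .y e.1 e.2.1 h else .x e.1 e.2.1 h

/-- The monomial of `G` with lexicographic edge-labels: the product of the variables of the
edges of `G`, in increasing lexicographic order. -/
def lexWord {n : ℕ} (G : Finset (Edge n)) : List (Gen n) :=
  (G.sort LexLE).map edgeVar

end BracketC

/-!
# Reduced forms of the Coxeter type element of the bracket algebra of type `C_n`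

A word in the variables is an ordered list of edges of a signed graph, and the edge between `i` and
`j` is given the root `e_i + e_j` or `e_i - e_j`, the loop at `i` the root `2 e_i`. In each
reduction the third variable belongs to the sum of the two roots that are being reduced. The proof
has three ingredients.

*Admissible words* (`Good`). The conditions of well-structured graphs on pairs of edges and the following
ordering rule are conditions on ordered pairs of letters: of two edges with a common endpoint `v`,
an edge incident to `v` with sign `-` comes before one incident with sign `+`, and edges of the same
sign are ordered lexicographically. Together with "connected, `n` edges, one loop" these conditions
are preserved by reductions (`Good.reduce`): a third letter is before both or after both of the two
reduced letters, which excludes the positions in which it would violate a condition afterwards.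
If an admissible word is irreducible, then its graph is alternating (`Good.alternating`): otherwise
a `-` edge and a `+` edge at the same vertex can be made adjacent, since every edge is a bridge of
the spanning tree. For an alternating graph the ordering rule is the lexicographic order of
noncommuting letters, so the word is determined by its graph up to commutations
(`Good.commEquiv_lexWord`).

*Subdivision of cones.* Let `p` be a point whose coordinates are linearly independent over `ℚ`. A
reduction divides the open cone spanned by the roots of a word by one or two hyperplanes; `p` is not
on them, as fewer than `n` roots cannot span `p`. Hence the number of words whose cone contains `p`
is invariant under reductions (`Generic.ind_cone_reduce`), and it is `1` if the cone of the Coxeter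
type element contains `p`.

*Disjointness.* The cones of distinct alternating well-structured graphs are disjoint
(`Flow.graph_eq`). If a point is a positive combination of the roots of two such graphs, compare the
coefficients on a shortest negative edge where they differ, then on a longest positive one, then on
the loops: balancing the coefficients at both endpoints gives two edges of the same graph that cross
or are nested in a forbidden way.

Every alternating well-structured graph `G` has a generic point in its cone
(`exists_generic_flow`), which lies in the cone of the Coxeter type element
(`Generic.mem_cone_pathEdges`). So exactly one leaf of a reduction tree has a cone containing this
point, and that is the leaf with graph `G`. For polynomials the same count is a linear functional
that is invariant under rewriting (`evalSigned_reflTransGen`); signs of `x_ij` with `i > j` are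
absorbed in signed coefficients, which stay nonnegative, so that no cancellation occurs.
-/

namespace BracketC

variable {n : ℕ}

/-! ### Edges attached to the variables -/

/-- The edge of a variable: `x_ij` and `x_ji` give the negative edge, `y_ij` and `y_ji` the
positive edge between `i` and `j`, and `z_i` gives the loop at `i`. -/
def toEdge : Gen n → Edge n
  | .x i j _ => (min i j, max i j, minus)
  | .y i j _ => (min i j, max i j, plus)
  | .z i => (i, i, plus)

/-- The triples that are edges of signed graphs: smaller endpoint first, loops positive. -/
def Valid (e : Edge n) : Prop := e.1 ≤ e.2.1 ∧ (e.1 = e.2.1 → e.2.2 = plus)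

theorem toEdge_x {i j : Fin n} (h : i < j) : toEdge (.x i j h.ne) = (i, j, minus) := by
  simp [toEdge, h.le]

theorem toEdge_y {i j : Fin n} (h : i < j) : toEdge (.y i j h.ne) = (i, j, plus) := by
  simp [toEdge, h.le]

theorem toEdge_z (i : Fin n) : toEdge (.z i) = (i, i, plus) := rfl

theorem valid_toEdge (g : Gen n) : Valid (toEdge g) := by
  cases g with
  | x i j h => simpa [toEdge, Valid] using fun h' => absurd h' h
  | y i j h => simp [toEdge, Valid]
  | z i => simp [toEdge, Valid]

theorem toEdge_edgeVar {e : Edge n} (he : Valid e) : toEdge (edgeVar e) = e := by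
  obtain ⟨i, j, s⟩ := e
  obtain ⟨h1, h2⟩ := he
  simp only at h1 h2
  rcases eq_or_lt_of_le h1 with rfl | h
  · simp [edgeVar, toEdge, h2]
  · cases s <;> simp [edgeVar, toEdge, h.ne, h.le]

/-! ### Well-structured graphs whose edges are listed in an admissible order -/

/-- The conditions of well-structured graphs that restrict an ordered pair of edges. -/
def Compat (e f : Edge n) : Prop :=
  ¬ (e.1 < f.1 ∧ f.1 < e.2.1 ∧ e.2.1 < f.2.1) ∧
  (e.2.2 = plus → f.2.2 = plus → e.1 < e.2.1 → f.1 < f.2.1 → e.1 < f.2.1 ∧ f.1 < e.2.1) ∧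
  (e.2.2 = plus → f.2.2 = plus → e.1 = e.2.1 → f.1 < f.2.1 → f.1 ≤ e.1 ∧ e.1 ≤ f.2.1) ∧
  (e.1 = e.2.1 → f.2.2 = minus → ¬ (f.1 < e.1 ∧ e.1 < f.2.1)) ∧
  (e.2.2 = plus → f.2.2 = minus → e.1 < e.2.1 → ¬ (f.1 ≤ e.1 ∧ e.2.1 ≤ f.2.1))

/-- The rule by which `e` comes before `f` in the word of a graph, imposed at each common endpoint
`v`: if `e` and `f` are incident to `v` with the same sign, they are in lexicographic order,
otherwise the edge incident with sign `-` comes first. -/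
def InOrder (e f : Edge n) : Prop :=
  ∀ v, (v = e.1 ∨ v = e.2.1) → (v = f.1 ∨ v = f.2.1) →
    if incSign e v = incSign f v then LexLE e f else incSign e v = minus

/-- `e` may stand before `f` in the list of edges of a graph that arises in the reductions. -/
def Prec (e f : Edge n) : Prop := Compat e f ∧ Compat f e ∧ InOrder e f

/-- `e` and `f` have different pairs of endpoints and are not both loops. -/
def Sep (e f : Edge n) : Prop :=
  ¬ (e.1 = f.1 ∧ e.2.1 = f.2.1) ∧ ¬ (e.1 = e.2.1 ∧ f.1 = f.2.1)

theorem Sep.symm {e f : Edge n} (h : Sep e f) : Sep f e := by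
  unfold Sep at *; grind

theorem inOrder_iff (e f : Edge n) : InOrder e f ↔
    ((e.1 = f.1 ∨ e.1 = f.2.1) →
      if incSign e e.1 = incSign f e.1 then LexLE e f else incSign e e.1 = minus) ∧
    ((e.2.1 = f.1 ∨ e.2.1 = f.2.1) →
      if incSign e e.2.1 = incSign f e.2.1 then LexLE e f else incSign e e.2.1 = minus) := by
  constructor
  · intro h
    exact ⟨h _ (Or.inl rfl), h _ (Or.inr rfl)⟩
  · rintro ⟨h1, h2⟩ v (rfl | rfl) <;> assumption

/-- The edge list `es` is that of a connected graph on `[n]` with `n` edges, exactly one of which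
is a loop. Hence the nonloop edges form a spanning tree. -/
structure LoopTree (es : List (Edge n)) : Prop where
  valid : ∀ e ∈ es, Valid e
  length : es.length = n
  loops : es.countP (fun e => e.1 = e.2.1) = 1
  conn : (skeleton es.toFinset).Connected

/-- The edge lists that arise from the Coxeter type element by reductions. -/
structure Good (es : List (Edge n)) : Prop extends LoopTree es where
  prec : es.Pairwise Prec

theorem skeleton_adj {G : Finset (Edge n)} {i j : Fin n} :
    (skeleton G).Adj i j ↔ i ≠ j ∧ ((∃ ε, (i, j, ε) ∈ G) ∨ ∃ ε, (j, i, ε) ∈ G) := by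
  simp [skeleton, SimpleGraph.fromRel_adj]

theorem reachable_of_mem {G : Finset (Edge n)} {e : Edge n} (he : e ∈ G) :
    (skeleton G).Reachable e.1 e.2.1 := by
  by_cases h : e.1 = e.2.1
  · rw [h]
  · exact SimpleGraph.Adj.reachable (skeleton_adj.2 ⟨h, Or.inl ⟨e.2.2, he⟩⟩)

theorem reachable_mono_of_edges {G H : Finset (Edge n)}
    (h : ∀ e ∈ G, (skeleton H).Reachable e.1 e.2.1) {u v : Fin n}
    (huv : (skeleton G).Reachable u v) : (skeleton H).Reachable u v := by
  obtain ⟨p⟩ := huv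
  induction p with
  | nil => rfl
  | cons hadj _ ih =>
    refine SimpleGraph.Reachable.trans ?_ ih
    rcases (skeleton_adj.1 hadj).2 with ⟨ε, he⟩ | ⟨ε, he⟩
    · exact h _ he
    · exact (h _ he).symm

theorem skeleton_edgeSet_subset (es : List (Edge n)) :
    (skeleton es.toFinset).edgeSet ⊆
      (((es.filter (fun e => ¬ e.1 = e.2.1)).map (fun e => s(e.1, e.2.1))).toFinset :
        Set (Sym2 (Fin n))) := by
  intro s
  induction s with
  | h i j =>
    intro hs
    rw [SimpleGraph.mem_edgeSet, skeleton_adj] at hs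
    obtain ⟨hne, ⟨ε, he⟩ | ⟨ε, he⟩⟩ := hs
    · simp only [List.coe_toFinset, List.mem_map, Set.mem_ofPred_eq, List.mem_filter]
      exact ⟨_, ⟨List.mem_toFinset.1 he, by simpa using hne⟩, rfl⟩
    · simp only [List.coe_toFinset, List.mem_map, Set.mem_ofPred_eq, List.mem_filter]
      exact ⟨_, ⟨List.mem_toFinset.1 he, by simpa using hne.symm⟩, Sym2.eq_swap⟩

theorem LoopTree.card_nonloops {es : List (Edge n)} (h : LoopTree es) :
    (es.filter (fun e => ¬ e.1 = e.2.1)).length + 1 = n := by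
  have h1 := List.length_eq_countP_add_countP (fun e : Edge n => decide (e.1 = e.2.1)) (l := es)
  rw [h.loops, h.length] at h1
  rw [← List.countP_eq_length_filter]
  simp only [Bool.not_eq_true, decide_eq_false_iff_not, decide_not] at h1 ⊢
  omega

theorem LoopTree.card_ends {es : List (Edge n)} (h : LoopTree es) :
    n ≤ Nat.card (skeleton es.toFinset).edgeSet + 1 ∧
    Nat.card (skeleton es.toFinset).edgeSet ≤
      ((es.filter (fun e => ¬ e.1 = e.2.1)).map (fun e => s(e.1, e.2.1))).toFinset.card ∧
    ((es.filter (fun e => ¬ e.1 = e.2.1)).map (fun e => s(e.1, e.2.1))).toFinset.card ≤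
      (es.filter (fun e => ¬ e.1 = e.2.1)).length := by
  refine ⟨?_, ?_, ?_⟩
  · simpa using h.conn.card_vert_le_card_edgeSet_add_one
  · have := Set.ncard_le_ncard (skeleton_edgeSet_subset es) (Finset.finite_toSet _)
    rwa [Set.ncard_coe_finset, ← Nat.card_coe_set_eq] at this
  · exact (List.toFinset_card_le _).trans (by simp)

theorem LoopTree.isAcyclic {es : List (Edge n)} (h : LoopTree es) :
    (skeleton es.toFinset).IsAcyclic := by
  refine (SimpleGraph.isTree_iff_connected_and_card.2 ⟨h.conn, ?_⟩).isAcyclic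
  have h1 := h.card_nonloops
  obtain ⟨h2, h3, h4⟩ := h.card_ends
  simp only [Nat.card_eq_fintype_card, Fintype.card_fin] at *
  omega

theorem LoopTree.sep {es : List (Edge n)} (h : LoopTree es) : es.Pairwise Sep := by
  have h1 := h.card_nonloops
  obtain ⟨h2, h3, h4⟩ := h.card_ends
  have h5 : ((es.filter (fun e => ¬ e.1 = e.2.1)).map (fun e => s(e.1, e.2.1))).Nodup := by
    rw [← Multiset.coe_nodup, ← Multiset.toFinset_card_eq_card_iff_nodup]
    simp only [List.toFinset_coe, Multiset.coe_card, List.length_map]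
    omega
  have h6 : (es.filter (fun e => e.1 = e.2.1)).Pairwise (fun _ _ => False) := by
    have h7 : (es.filter (fun e => decide (e.1 = e.2.1))).length = 1 := by
      rw [← List.countP_eq_length_filter, h.loops]
    obtain ⟨e, he⟩ := List.length_eq_one_iff.1 h7
    rw [he]
    exact List.pairwise_singleton _ _
  rw [List.Nodup, List.pairwise_map, List.pairwise_filter] at h5
  rw [List.pairwise_filter] at h6
  refine (h5.and h6).imp ?_
  rintro e f ⟨h7, h8⟩
  simp only [decide_eq_true_eq] at h7 h8
  refine ⟨fun h9 => ?_, fun h9 => h8 h9.1 h9.2⟩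
  by_cases h10 : e.1 = e.2.1
  · exact h8 h10 (by rw [← h9.1, ← h9.2, h10])
  · exact h7 h10 (by rwa [← h9.1, ← h9.2]) (by rw [h9.1, h9.2])

theorem LoopTree.nodup {es : List (Edge n)} (h : LoopTree es) : es.Nodup :=
  h.sep.imp (fun h1 h2 => h1.1 (by simp [h2]))

/-! ### Reductions preserve admissible edge lists -/

/-- A third edge that may stand before (after) both `a` and `b` may also stand before (after) `c`.
The edges `a` and `b` are adjacent in the list, so every other edge is before both or after both. -/
def Inherits (a b c : Edge n) : Prop :=
  ∀ e, Valid e → Sep e a → Sep e b → Sep e c →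
    (Prec e a → Prec e b → Prec e c) ∧ (Prec a e → Prec b e → Prec c e)

theorem inherits_left (a b : Edge n) : Inherits a b a := fun _ _ _ _ _ => by tauto

theorem inherits_right (a b : Edge n) : Inherits a b b := fun _ _ _ _ _ => by tauto

theorem inherits_xx {i j k : Fin n} (h : i < j) (h' : j < k) :
    Inherits (i, j, minus) (j, k, minus) (i, k, minus) := by
  rintro ⟨p, q, s⟩
  cases s <;>
  simp only [Valid, Sep, Prec, Compat, inOrder_iff, LexLE, incSign, plus, minus, Fin.ext_iff,
    Fin.lt_def, Fin.le_def] at * <;> intros <;> constructor <;> grind (splits := 30)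

theorem inherits_xy {i j k : Fin n} (h : i < j) (h' : j < k) :
    Inherits (i, j, minus) (j, k, plus) (i, k, plus) := by
  rintro ⟨p, q, s⟩
  cases s <;>
  simp only [Valid, Sep, Prec, Compat, inOrder_iff, LexLE, incSign, plus, minus, Fin.ext_iff,
    Fin.lt_def, Fin.le_def] at * <;> intros <;> constructor <;> grind (splits := 30)

theorem inherits_xy_right {i j k : Fin n} (h : i < j) (h' : j < k) :
    Inherits (j, k, minus) (i, k, plus) (i, j, plus) := by
  rintro ⟨p, q, s⟩
  cases s <;>
  simp only [Valid, Sep, Prec, Compat, inOrder_iff, LexLE, incSign, plus, minus, Fin.ext_iff,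
    Fin.lt_def, Fin.le_def] at * <;> intros <;> constructor <;> grind (splits := 30)

theorem inherits_xz_loop {i j : Fin n} (h : i < j) :
    Inherits (i, j, minus) (j, j, plus) (i, i, plus) := by
  rintro ⟨p, q, s⟩
  cases s <;>
  simp only [Valid, Sep, Prec, Compat, inOrder_iff, LexLE, incSign, plus, minus, Fin.ext_iff,
    Fin.lt_def, Fin.le_def] at * <;> intros <;> constructor <;> grind (splits := 30)

theorem inherits_xz {i j : Fin n} (h : i < j) :
    Inherits (i, j, minus) (j, j, plus) (i, j, plus) := by
  rintro ⟨p, q, s⟩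
  cases s <;>
  simp only [Valid, Sep, Prec, Compat, inOrder_iff, LexLE, incSign, plus, minus, Fin.ext_iff,
    Fin.lt_def, Fin.le_def] at * <;> intros <;> constructor <;> grind (splits := 30)

theorem Good.replace {u v : List (Edge n)} {a b c d : Edge n} (h : Good (u ++ [a, b] ++ v))
    (hc : Valid c) (hd : Valid d)
    (hl : [a, b].countP (fun e => e.1 = e.2.1) = [c, d].countP (fun e => e.1 = e.2.1))
    (hr : ∀ G : SimpleGraph (Fin n), G.Reachable c.1 c.2.1 → G.Reachable d.1 d.2.1 →
      G.Reachable a.1 a.2.1 ∧ G.Reachable b.1 b.2.1)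
    (hcd : Prec c d) (hic : Inherits a b c) (hid : Inherits a b d) :
    Good (u ++ [c, d] ++ v) := by
  have hT : LoopTree (u ++ [c, d] ++ v) := by
    refine ⟨?_, ?_, ?_, ?_⟩
    · intro e he
      have := h.valid e
      simp only [List.mem_append, List.mem_cons, List.not_mem_nil, or_false] at he this
      rcases he with (he | rfl | rfl) | he <;> tauto
    · have := h.length
      simpa using this
    · have := h.loops
      rw [List.countP_append, List.countP_append] at this ⊢
      rw [← hl, this]
    · have hn := h.conn.nonempty
      refine ⟨fun p q => ?_⟩
      refine reachable_mono_of_edges (fun e he => ?_) (h.conn.preconnected p q)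
      obtain ⟨h1, h2⟩ := hr (skeleton (u ++ [c, d] ++ v).toFinset)
        (reachable_of_mem (by simp)) (reachable_of_mem (by simp))
      simp only [List.mem_toFinset, List.mem_append, List.mem_cons, List.not_mem_nil,
        or_false] at he
      rcases he with (he | rfl | rfl) | he
      · exact reachable_of_mem (by simp [he])
      · exact h1
      · exact h2
      · exact reachable_of_mem (by simp [he])
  refine ⟨hT, ?_⟩
  have hs := h.sep
  have hs' := hT.sep
  have hp := h.prec
  have hv := h.valid
  simp only [List.pairwise_append, List.pairwise_cons, List.mem_append, List.mem_cons,
    List.not_mem_nil, or_false] at hs hs' hp hv ⊢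
  obtain ⟨⟨su, sab, suab⟩, sv, sabv⟩ := hs
  obtain ⟨⟨tu, tab, tuab⟩, tv, tabv⟩ := hs'
  obtain ⟨⟨pu, pab, puab⟩, pv, pabv⟩ := hp
  refine ⟨⟨pu, ⟨by rintro _ rfl; exact hcd, by simp⟩, ?_⟩, pv, ?_⟩
  · intro e he f hf
    have hve := hv e (by tauto)
    have ha := suab e he a (by tauto)
    have hb := suab e he b (by tauto)
    have hf' := tuab e he f (by tauto)
    have hpa := puab e he a (by tauto)
    have hpb := puab e he b (by tauto)
    rcases hf with rfl | rfl
    · exact (hic e hve ha hb hf').1 hpa hpb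
    · exact (hid e hve ha hb hf').1 hpa hpb
  · intro f hf e he
    have hve := hv e (by tauto)
    have ha := (sabv a (by tauto) e he).symm
    have hb := (sabv b (by tauto) e he).symm
    have hf' := (tabv f (by tauto) e he).symm
    have hpa := pabv a (by tauto) e he
    have hpb := pabv b (by tauto) e he
    rcases hf with hf | rfl | rfl
    · exact pabv f (by tauto) e he
    · exact (hic e hve ha hb hf').2 hpa hpb
    · exact (hid e hve ha hb hf').2 hpa hpb

theorem Good.reduce {u v : List (Edge n)} {a b : Gen n} {rs : List (List (Gen n))}
    (h : Good (u ++ [toEdge a, toEdge b] ++ v)) (hr : ReductionRule a b rs) :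
    ∀ r ∈ rs, Good (u ++ r.map toEdge ++ v) := by
  have hab : Prec (toEdge a) (toEdge b) := by
    have := h.prec
    simp only [List.pairwise_append, List.pairwise_cons, List.mem_cons] at this
    exact this.1.2.1.1 _ (by simp)
  cases hr with
  | @xx i j k h1 h2 =>
    have h3 := h1.trans h2
    simp only [toEdge_x h1, toEdge_x h2] at h
    simp only [List.mem_cons, List.not_mem_nil, or_false, forall_eq_or_imp, forall_eq,
      List.map_cons, List.map_nil, toEdge_x h1, toEdge_x h2, toEdge_x h3]
    refine ⟨h.replace ⟨h3.le, by simp [h3.ne]⟩ ⟨h1.le, by simp [h1.ne]⟩ (by simp [*, ne_of_lt])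
        (fun G r1 r2 => ⟨r2, r2.symm.trans r1⟩) ?_ (inherits_xx h1 h2) (inherits_left _ _),
      h.replace ⟨h2.le, by simp [h2.ne]⟩ ⟨h3.le, by simp [h3.ne]⟩ (by simp [*, ne_of_lt])
        (fun G r1 r2 => ⟨r2.trans r1.symm, r1⟩) ?_ (inherits_right _ _) (inherits_xx h1 h2)⟩ <;>
    · simp only [Prec, Compat, inOrder_iff, LexLE, incSign, plus, minus]
      grind (splits := 30)
  | @xy i j k h1 h2 =>
    have h3 := h1.trans h2
    simp only [toEdge_x h1, toEdge_y h2] at h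
    simp only [List.mem_cons, List.not_mem_nil, or_false, forall_eq_or_imp, forall_eq,
      List.map_cons, List.map_nil, toEdge_x h1, toEdge_y h2, toEdge_y h3]
    refine ⟨h.replace ⟨h3.le, by simp [h3.ne]⟩ ⟨h1.le, by simp [h1.ne]⟩ (by simp [*, ne_of_lt])
        (fun G r1 r2 => ⟨r2, r2.symm.trans r1⟩) ?_ (inherits_xy h1 h2) (inherits_left _ _),
      h.replace ⟨h2.le, by simp [h2.ne]⟩ ⟨h3.le, by simp [h3.ne]⟩ (by simp [*, ne_of_lt])
        (fun G r1 r2 => ⟨r2.trans r1.symm, r1⟩) ?_ (inherits_right _ _) (inherits_xy h1 h2)⟩ <;>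
    · simp only [Prec, Compat, inOrder_iff, LexLE, incSign, plus, minus]
      grind (splits := 30)
  | @yxMax' i j k h1 h2 =>
    have h3 := h1.trans h2
    simp only [toEdge_x h2, toEdge_y h3] at h
    simp only [List.mem_cons, List.not_mem_nil, or_false, forall_eq_or_imp, forall_eq,
      List.map_cons, List.map_nil, toEdge_y h1, toEdge_x h2, toEdge_y h3]
    refine ⟨h.replace ⟨h1.le, by simp [h1.ne]⟩ ⟨h2.le, by simp [h2.ne]⟩ (by simp [*, ne_of_lt])
        (fun G r1 r2 => ⟨r2, r1.trans r2⟩) ?_ (inherits_xy_right h1 h2) (inherits_left _ _),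
      h.replace ⟨h3.le, by simp [h3.ne]⟩ ⟨h1.le, by simp [h1.ne]⟩ (by simp [*, ne_of_lt])
        (fun G r1 r2 => ⟨r2.symm.trans r1, r1⟩) ?_ (inherits_right _ _)
        (inherits_xy_right h1 h2)⟩ <;>
    · simp only [Prec, Compat, inOrder_iff, LexLE, incSign, plus, minus]
      grind (splits := 30)
  | @xz i j h1 =>
    simp only [toEdge_x h1, toEdge_z] at h
    simp only [List.mem_cons, List.not_mem_nil, or_false, forall_eq_or_imp, forall_eq,
      List.map_cons, List.map_nil, toEdge_x h1, toEdge_y h1, toEdge_z]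
    refine ⟨h.replace ⟨le_rfl, by simp⟩ ⟨h1.le, by simp [h1.ne]⟩ (by simp [*, ne_of_lt])
        (fun G r1 r2 => ⟨r2, .rfl⟩) ?_ (inherits_xz_loop h1) (inherits_left _ _),
      h.replace ⟨h1.le, by simp [h1.ne]⟩ ⟨le_rfl, by simp⟩ (by simp [*, ne_of_lt])
        (fun G r1 r2 => ⟨r1, .rfl⟩) ?_ (inherits_xz h1) (inherits_xz_loop h1),
      h.replace ⟨le_rfl, by simp⟩ ⟨h1.le, by simp [h1.ne]⟩ (by simp [*, ne_of_lt])
        (fun G r1 r2 => ⟨r2, .rfl⟩) ?_ (inherits_right _ _) (inherits_xz h1)⟩ <;>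
    · simp only [Prec, Compat, inOrder_iff, LexLE, incSign, plus, minus]
      grind (splits := 30)
  -- In the other cases the two variables are not in the order that an admissible list requires,
  -- or (for `x_ik y_jk`) a positive edge is nested in a negative one.
  | @xx' i j k h1 h2 =>
    simp only [toEdge_x h1, toEdge_x h2, Prec, Compat, inOrder_iff, LexLE, incSign, plus,
      minus] at hab
    grind (splits := 30)
  | @xy' i j k h1 h2 =>
    simp only [toEdge_x h1, toEdge_y h2, Prec, Compat, inOrder_iff, LexLE, incSign, plus,
      minus] at hab
    grind (splits := 30)
  | @xyMax i j k h1 h2 =>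
    simp only [toEdge_x (h1.trans h2), toEdge_y h2, Prec, Compat, inOrder_iff, LexLE, incSign,
      plus, minus] at hab
    grind (splits := 30)
  | @xyMax' i j k h1 h2 =>
    simp only [toEdge_x (h1.trans h2), toEdge_y h2, Prec, Compat, inOrder_iff, LexLE, incSign,
      plus, minus] at hab
    grind (splits := 30)
  | @yxMax i j k h1 h2 =>
    simp only [toEdge_y (h1.trans h2), toEdge_x h2, Prec, Compat, inOrder_iff, LexLE, incSign,
      plus, minus] at hab
    grind (splits := 30)
  | @xz' i j h1 =>
    simp only [toEdge_x h1, toEdge_z, Prec, Compat, inOrder_iff, LexLE, incSign, plus,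
      minus] at hab
    grind (splits := 30)

/-! ### Commutations -/

/-- `e` and `f` have no common endpoint, or both are loops: the variables of `e` and `f` commute. -/
def Apart (e f : Edge n) : Prop :=
  (e.1 ≠ f.1 ∧ e.1 ≠ f.2.1 ∧ e.2.1 ≠ f.1 ∧ e.2.1 ≠ f.2.1) ∨ (e.1 = e.2.1 ∧ f.1 = f.2.1)

theorem Apart.symm {e f : Edge n} (h : Apart e f) : Apart f e := by
  unfold Apart at *; grind

theorem Commute₂.apart {a b : Gen n} (h : Commute₂ a b) : Apart (toEdge a) (toEdge b) := by
  cases h with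
  | zz i j => simp [Apart, toEdge]
  | xx hij hkl h => left; simpa [toEdge, hij.le, hkl.le] using h
  | yx hij hkl h => left; simpa [toEdge, hij.le, hkl.le] using h
  | yy hij hkl h => left; simpa [toEdge, hij.le, hkl.le] using h
  | zx hkl h => left; simp only [toEdge]; grind
  | zy hkl h => left; simp only [toEdge]; grind

theorem Apart.commute {e f : Edge n} (he : Valid e) (hf : Valid f) (h : Apart e f) :
    Commute₂ (edgeVar e) (edgeVar f) ∨ Commute₂ (edgeVar f) (edgeVar e) := by
  obtain ⟨i, j, s⟩ := e
  obtain ⟨k, l, t⟩ := f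
  obtain ⟨he1, he2⟩ := he
  obtain ⟨hf1, hf2⟩ := hf
  simp only [Apart] at he1 he2 hf1 hf2 h
  rcases eq_or_lt_of_le he1 with rfl | he1 <;> rcases eq_or_lt_of_le hf1 with rfl | hf1
  · simpa [edgeVar] using Or.inl (Commute₂.zz i k)
  · have : i ≠ k ∧ i ≠ l := by grind
    left
    cases t
    · simpa [edgeVar, hf1.ne] using Commute₂.zx hf1.ne this
    · simpa [edgeVar, hf1.ne] using Commute₂.zy hf1.ne this
  · have : k ≠ i ∧ k ≠ j := by grind
    right
    cases s
    · simpa [edgeVar, he1.ne] using Commute₂.zx he1.ne this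
    · simpa [edgeVar, he1.ne] using Commute₂.zy he1.ne this
  · have h1 : i ≠ k ∧ i ≠ l ∧ j ≠ k ∧ j ≠ l := by grind
    have h2 : k ≠ i ∧ k ≠ j ∧ l ≠ i ∧ l ≠ j := by grind
    cases s <;> cases t <;> simp only [edgeVar, he1.ne, hf1.ne]
    · exact Or.inl (Commute₂.xx he1 hf1 h1)
    · exact Or.inr (Commute₂.yx hf1 he1 h2)
    · exact Or.inl (Commute₂.yx he1 hf1 h1)
    · exact Or.inl (Commute₂.yy he1 hf1 h1)

theorem Prec.of_apart {e f : Edge n} (h : Prec e f) (hs : Sep e f) (ha : Apart e f) :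
    Prec f e := by
  refine ⟨h.2.1, h.1, fun v h1 h2 => ?_⟩
  unfold Sep Apart at *
  grind

theorem SwapStep.symm {w w' : List (Gen n)} (h : SwapStep w w') : SwapStep w' w := by
  obtain ⟨u, a, b, v, h, rfl, rfl⟩ := h
  exact ⟨u, b, a, v, h.symm, rfl, rfl⟩

theorem CommEquiv.symm {w w' : List (Gen n)} (h : CommEquiv w w') : CommEquiv w' w := by
  induction h with
  | refl => exact .refl
  | tail _ h ih => exact .head h.symm ih

theorem CommEquiv.trans {w w' w'' : List (Gen n)} (h : CommEquiv w w') (h' : CommEquiv w' w'') :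
    CommEquiv w w'' := Relation.ReflTransGen.trans h h'

theorem CommEquiv.append {w w' : List (Gen n)} (h : CommEquiv w w') (u v : List (Gen n)) :
    CommEquiv (u ++ w ++ v) (u ++ w' ++ v) := by
  induction h with
  | refl => exact .refl
  | tail _ h ih =>
    obtain ⟨u', a, b, v', h, rfl, rfl⟩ := h
    exact .tail ih ⟨u ++ u', a, b, v' ++ v, h, by simp, by simp⟩

theorem CommEquiv.swap {a b : Gen n} (h : Commute₂ a b ∨ Commute₂ b a) :
    CommEquiv [a, b] [b, a] := .single ⟨[], a, b, [], h, rfl, rfl⟩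

theorem CommEquiv.perm {w w' : List (Gen n)} (h : CommEquiv w w') : w.Perm w' := by
  induction h with
  | refl => rfl
  | tail _ h ih =>
    obtain ⟨u, a, b, v, h, rfl, rfl⟩ := h
    refine ih.trans (List.Perm.append_right _ (List.Perm.append_left _ ?_))
    exact List.Perm.swap _ _ _

theorem commEquiv_cons_append {a : Gen n} {m : List (Gen n)}
    (h : ∀ g ∈ m, Commute₂ a g ∨ Commute₂ g a) : CommEquiv (a :: m) (m ++ [a]) := by
  induction m with
  | nil => exact .refl
  | cons g m ih =>
    have h1 := (CommEquiv.swap (h g (by simp))).append [] m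
    have h2 := (ih (fun g hg => h g (by simp [hg]))).append [g] []
    simp only [List.nil_append, List.append_nil, List.cons_append] at h1 h2
    exact h1.trans h2

theorem commEquiv_filter (p : Gen n → Prop) [DecidablePred p] (m : List (Gen n))
    (h : ∀ g ∈ m, ∀ g' ∈ m, p g → ¬ p g' → Commute₂ g g' ∨ Commute₂ g' g) :
    CommEquiv m (m.filter (fun g => ¬ p g) ++ m.filter p) := by
  induction m with
  | nil => exact .refl
  | cons g m ih =>
    have h1 := (ih (fun a ha b hb => h a (by simp [ha]) b (by simp [hb]))).append [g] []
    by_cases hg : p g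
    · have h2 : CommEquiv (g :: m.filter (fun g => ¬ p g)) (m.filter (fun g => ¬ p g) ++ [g]) :=
        commEquiv_cons_append fun g' hg' => by
          simp only [List.mem_filter, decide_eq_true_eq] at hg'
          exact h g (by simp) g' (by simp [hg'.1]) hg hg'.2
      have h3 := h2.append [] (m.filter p)
      simp only [List.nil_append, List.append_nil, List.cons_append, List.append_assoc] at h1 h3
      simpa [List.filter_cons, hg] using h1.trans h3
    · simpa [List.filter_cons, hg] using h1

theorem LoopTree.perm {es es' : List (Edge n)} (h : LoopTree es) (hp : es.Perm es') :
    LoopTree es' :=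
  ⟨fun e he => h.valid e (hp.mem_iff.2 he), hp.length_eq ▸ h.length,
    (hp.countP_eq _).symm.trans h.loops, List.toFinset_eq_of_perm _ _ hp ▸ h.conn⟩

theorem Good.swap {u v : List (Edge n)} {a b : Edge n} (h : Good (u ++ [a, b] ++ v))
    (hab : Apart a b) : Good (u ++ [b, a] ++ v) := by
  refine ⟨h.toLoopTree.perm
    (List.Perm.append_right _ (List.Perm.append_left _ (List.Perm.swap _ _ _))), ?_⟩
  have hs := h.sep
  have hp := h.prec
  simp only [List.pairwise_append, List.pairwise_cons, List.mem_append, List.mem_cons,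
    List.not_mem_nil, or_false] at hs hp ⊢
  obtain ⟨⟨su, sab, suab⟩, sv, sabv⟩ := hs
  obtain ⟨⟨pu, pab, puab⟩, pv, pabv⟩ := hp
  refine ⟨⟨pu, ⟨?_, by simp⟩, fun e he f hf => puab e he f hf.symm⟩, pv,
    fun f hf e he => pabv f (by tauto) e he⟩
  rintro _ rfl
  exact (pab.1 b rfl).of_apart (sab.1 b rfl) hab

theorem Good.commEquiv {w w' : List (Gen n)} (h : Good (w.map toEdge)) (hw : CommEquiv w w') :
    Good (w'.map toEdge) := by
  induction hw with
  | refl => exact h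
  | tail _ hs ih =>
    obtain ⟨u, a, b, v, hab, rfl, rfl⟩ := hs
    simp only [List.map_append, List.map_cons, List.map_nil] at ih ⊢
    exact ih.swap (hab.elim Commute₂.apart fun h => h.apart.symm)

/-! ### Irreducible words -/

/-- All variables `x_ij`, `y_ij` in the word `w` are written with `i < j`. -/
def Ascending (w : List (Gen n)) : Prop := ∀ g ∈ w, edgeVar (toEdge g) = g

/-- No reduction applies to the word `w`, even after commutations. -/
def IrredWord (w : List (Gen n)) : Prop :=
  ∀ u a b v rs, CommEquiv w (u ++ [a, b] ++ v) → ¬ ReductionRule a b rs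

theorem exists_first {α : Type*} {p : α → Prop} {l : List α} (h : ∃ x ∈ l, p x) :
    ∃ l₁ b l₂, l = l₁ ++ b :: l₂ ∧ p b ∧ ∀ x ∈ l₁, ¬ p x := by
  induction l with
  | nil => simp at h
  | cons a l ih =>
    by_cases ha : p a
    · exact ⟨[], a, l, rfl, ha, by simp⟩
    · obtain ⟨l₁, b, l₂, rfl, hb, h1⟩ := ih (by
        obtain ⟨x, hx, hpx⟩ := h
        rcases List.mem_cons.1 hx with rfl | hx
        · exact absurd hpx ha
        · exact ⟨x, hx, hpx⟩)
      refine ⟨a :: l₁, b, l₂, rfl, hb, ?_⟩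
      simpa [ha] using h1

theorem exists_last {α : Type*} {p : α → Prop} {l : List α} (h : ∃ x ∈ l, p x) :
    ∃ l₁ b l₂, l = l₁ ++ b :: l₂ ∧ p b ∧ ∀ x ∈ l₂, ¬ p x := by
  obtain ⟨l₁, b, l₂, h1, h2, h3⟩ := exists_first (l := l.reverse) (p := p) (by simpa using h)
  refine ⟨l₂.reverse, b, l₁.reverse, ?_, h2, by simpa using h3⟩
  rw [← List.reverse_reverse l, h1]
  simp

/-- A reduction applies to adjacent variables whose edges are incident to a common vertex `v` with
different signs. -/
theorem exists_reductionRule {e f : Edge n} (he : Valid e) (hf : Valid f) (hs : Sep e f)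
    (hp : Prec e f) {v : Fin n} (hev : v = e.1 ∨ v = e.2.1) (hfv : v = f.1 ∨ v = f.2.1)
    (h1 : incSign e v = minus) (h2 : incSign f v = plus) :
    ∃ rs, ReductionRule (edgeVar e) (edgeVar f) rs := by
  obtain ⟨i, j, s⟩ := e
  obtain ⟨k, l, t⟩ := f
  have hij : s = minus ∧ j = v ∧ i < j := by
    clear hp hf
    simp only [Valid, Sep, incSign, plus, minus] at *
    grind
  obtain ⟨rfl, rfl, hij⟩ := hij
  obtain ⟨hf1, hf2⟩ := hf
  simp only at hf1 hf2 hfv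
  rcases eq_or_lt_of_le hf1 with rfl | hkl
  · obtain rfl : j = k := by tauto
    simp only [edgeVar, hij.ne]
    exact ⟨_, ReductionRule.xz hij⟩
  · cases t
    · have : j = k := by
        simp only [incSign, plus, minus] at *
        grind
      subst this
      simp only [edgeVar, hij.ne, hkl.ne]
      exact ⟨_, ReductionRule.xx hij hkl⟩
    · rcases hfv with rfl | rfl
      · simp only [edgeVar, hij.ne, hkl.ne]
        exact ⟨_, ReductionRule.xy hij hkl⟩
      · have hki : k < i := by
          simp only [Sep, Prec, Compat, plus, minus] at *
          grind
        simp only [edgeVar, hij.ne, hkl.ne]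
        exact ⟨_, ReductionRule.yxMax' hki hij⟩

theorem apart_of_sides {S : Fin n → Prop} {e f : Edge n} (h1 : S e.1) (h2 : S e.2.1)
    (h3 : ¬ S f.1) (h4 : ¬ S f.2.1) : Apart e f :=
  Or.inl ⟨fun h => h3 (h ▸ h1), fun h => h4 (h ▸ h1), fun h => h3 (h ▸ h2), fun h => h4 (h ▸ h2)⟩

theorem Ascending.commute {w : List (Gen n)} (hw : Ascending w) {g g' : Gen n} (hg : g ∈ w)
    (hg' : g' ∈ w) (h : Apart (toEdge g) (toEdge g')) : Commute₂ g g' ∨ Commute₂ g' g := by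
  have := h.commute (valid_toEdge g) (valid_toEdge g')
  rwa [hw g hg, hw g' hg'] at this

/-- If `a` joins the vertex `i` of `S` to the vertex `v` outside of `S`, each variable between `a`
and `b` stays on one side of `S` and avoids `v`, and `b` is outside of `S`, then `a` and `b` can be
made adjacent: the variables inside `S` commute with `b`, the other ones commute with `a` and with
those inside `S`. -/
theorem commEquiv_adjacent {u m t : List (Gen n)} {a b : Gen n}
    (hw : Ascending (u ++ a :: m ++ b :: t)) (S : Fin n → Prop)
    (ha : S (toEdge a).1) (hb : ¬ S (toEdge b).1 ∧ ¬ S (toEdge b).2.1)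
    (hside : ∀ g ∈ m, (S (toEdge g).1 ↔ S (toEdge g).2.1))
    (hm : ∀ g ∈ m, ¬ ((toEdge a).2.1 = (toEdge g).1 ∨ (toEdge a).2.1 = (toEdge g).2.1)) :
    ∃ u' t', CommEquiv (u ++ a :: m ++ b :: t) (u' ++ [a, b] ++ t') := by
  classical
  have e1 : CommEquiv m (m.filter (fun g => ¬ S (toEdge g).1) ++
      m.filter (fun g => S (toEdge g).1)) :=
    commEquiv_filter (fun g => S (toEdge g).1) m fun g hg g' hg' h1 h2 =>
      hw.commute (by simp [hg]) (by simp [hg'])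
        (apart_of_sides h1 ((hside g hg).1 h1) h2 fun h => h2 ((hside g' hg').2 h))
  have e2 : CommEquiv (a :: m.filter (fun g => ¬ S (toEdge g).1))
      (m.filter (fun g => ¬ S (toEdge g).1) ++ [a]) := by
    refine commEquiv_cons_append fun g hg => ?_
    simp only [List.mem_filter, decide_eq_true_eq] at hg
    obtain ⟨hg, hgS⟩ := hg
    have h1 := hm g hg
    exact hw.commute (by simp) (by simp [hg]) (Or.inl ⟨fun h => hgS (h ▸ ha),
      fun h => hgS ((hside g hg).2 (h ▸ ha)), fun h => h1 (Or.inl h), fun h => h1 (Or.inr h)⟩)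
  have e3 : CommEquiv (b :: m.filter (fun g => S (toEdge g).1))
      (m.filter (fun g => S (toEdge g).1) ++ [b]) := by
    refine commEquiv_cons_append fun g hg => ?_
    simp only [List.mem_filter, decide_eq_true_eq] at hg
    exact hw.commute (by simp) (by simp [hg.1])
      (apart_of_sides hg.2 ((hside g hg.1).1 hg.2) hb.1 hb.2).symm
  refine ⟨u ++ m.filter (fun g => ¬ S (toEdge g).1), m.filter (fun g => S (toEdge g).1) ++ t, ?_⟩
  have h1 := e1.append (u ++ [a]) (b :: t)
  have h2 := e2.append u (m.filter (fun g => S (toEdge g).1) ++ b :: t)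
  have h3 := e3.symm.append (u ++ m.filter (fun g => ¬ S (toEdge g).1) ++ [a]) t
  simp only [List.append_assoc, List.cons_append, List.nil_append] at h1 h2 h3 ⊢
  exact (h1.trans h2).trans h3

/-- The edges at `v` are ordered linearly in the word, the ones with sign `-` first. If both signs
occur, take the last edge `a` with sign `-` and the first edge `b` with sign `+`. In the spanning
tree, `a` is a bridge, and each variable between `a` and `b` lies on one side of it, so that `a`
and `b` can be made adjacent. -/
theorem Good.alternating {w : List (Gen n)} (h : Good (w.map toEdge)) (hw : Ascending w)
    (hirr : IrredWord w) : Alternating (w.map toEdge).toFinset := by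
  by_contra hna
  have hsplit : ∃ v, (∃ g ∈ w, (v = (toEdge g).1 ∨ v = (toEdge g).2.1) ∧
      incSign (toEdge g) v = minus) ∧ ∃ g ∈ w, (v = (toEdge g).1 ∨ v = (toEdge g).2.1) ∧
      incSign (toEdge g) v = plus := by
    simp only [Alternating, List.mem_toFinset, List.mem_map, not_forall] at hna
    obtain ⟨v, _, ⟨g, hg, rfl⟩, _, ⟨g', hg', rfl⟩, h1, h2, h3⟩ := hna
    refine ⟨v, ?_⟩
    cases h4 : incSign (toEdge g) v <;> cases h5 : incSign (toEdge g') v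
    · simp_all
    · exact ⟨⟨g, hg, h1, h4⟩, ⟨g', hg', h2, h5⟩⟩
    · exact ⟨⟨g', hg', h2, h5⟩, ⟨g, hg, h1, h4⟩⟩
    · simp_all
  obtain ⟨v, ⟨g₀, hg₀, hg₀v, hg₀s⟩, hplus⟩ := hsplit
  obtain ⟨l₁, b, t, rfl, ⟨hbv, hbs⟩, hl₁⟩ := exists_first hplus
  have hg₀l : g₀ ∈ l₁ := by
    have hp := h.prec
    simp only [List.pairwise_map, List.pairwise_append, List.pairwise_cons] at hp
    rcases List.mem_append.1 hg₀ with h1 | h1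
    · exact h1
    rcases List.mem_cons.1 h1 with rfl | h1
    · simp_all
    · have := (hp.2.1.1 _ h1).2.2 v hbv hg₀v
      simp [hbs, hg₀s] at this
  obtain ⟨u, a, m, rfl, hav, hm⟩ :=
    exists_last (p := fun g => v = (toEdge g).1 ∨ v = (toEdge g).2.1) ⟨g₀, hg₀l, hg₀v⟩
  have has : incSign (toEdge a) v = minus := by
    have := hl₁ a (by simp)
    cases h4 : incSign (toEdge a) v <;> simp_all
  have hsep := h.sep
  have hprec := h.prec
  simp only [List.pairwise_map, List.pairwise_append, List.pairwise_cons] at hsep hprec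
  have hprec_ab : Prec (toEdge a) (toEdge b) := hprec.2.2 a (by simp) b (by simp)
  have ham : ∀ g ∈ m ++ [b], Sep (toEdge a) (toEdge g) := by
    intro g hg
    rcases List.mem_append.1 hg with hg | hg
    · exact hsep.1.2.1.1 g hg
    · obtain rfl := List.mem_singleton.1 hg
      exact hsep.2.2 a (by simp) g (by simp)
  obtain ⟨rs, hrs⟩ := exists_reductionRule (valid_toEdge a) (valid_toEdge b) (ham b (by simp))
    hprec_ab hav hbv has hbs
  rw [hw a (by simp), hw b (by simp)] at hrs
  obtain ⟨i, hai, hiv⟩ : ∃ i, toEdge a = (i, v, minus) ∧ i < v := by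
    have hva := valid_toEdge a
    clear hprec hsep hprec_ab ham
    generalize toEdge a = e at hva hav has
    obtain ⟨i, j, s⟩ := e
    refine ⟨i, ?_⟩
    simp only [Valid, incSign, plus, minus] at *
    grind
  -- `S` is the far side of the bridge `a`
  obtain ⟨S, hiS, hvS, hside⟩ : ∃ S : Fin n → Prop, S i ∧ ¬ S v ∧
      ∀ g ∈ m ++ [b], (S (toEdge g).1 ↔ S (toEdge g).2.1) := by
    set G := skeleton ((u ++ a :: m ++ b :: t).map toEdge).toFinset with hG
    have hadj : G.Adj i v := skeleton_adj.2 ⟨hiv.ne, Or.inl ⟨minus, by simp [← hai]⟩⟩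
    refine ⟨fun x => (G \ SimpleGraph.fromEdgeSet {s(i, v)}).Reachable i x,
      SimpleGraph.Reachable.refl _, SimpleGraph.isBridge_iff.1
        (SimpleGraph.isAcyclic_iff_forall_adj_isBridge.1 h.isAcyclic hadj), ?_⟩
    intro g hg
    by_cases hl : (toEdge g).1 = (toEdge g).2.1
    · rw [hl]
    have hvg := (valid_toEdge g).1
    have hsg := (ham g hg).1
    have hadj' : (G \ SimpleGraph.fromEdgeSet {s(i, v)}).Adj (toEdge g).1 (toEdge g).2.1 := by
      rw [SimpleGraph.sdiff_adj, SimpleGraph.fromEdgeSet_adj]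
      refine ⟨skeleton_adj.2 ⟨hl, Or.inl ⟨(toEdge g).2.2, ?_⟩⟩, ?_⟩
      · have : g ∈ u ++ a :: m ++ b :: t := by
          rcases List.mem_append.1 hg with h1 | h1
          · simp [h1]
          · simp [List.mem_singleton.1 h1]
        exact List.mem_toFinset.2 (List.mem_map_of_mem this)
      · rintro ⟨h1, -⟩
        rw [Set.mem_singleton_iff, Sym2.eq_iff] at h1
        rw [hai] at hsg
        rcases h1 with ⟨h1, h2⟩ | ⟨h1, h2⟩
        · exact hsg ⟨h1.symm, h2.symm⟩
        · rw [h1, h2] at hvg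
          exact absurd hvg (not_le.2 hiv)
    exact ⟨fun h => h.trans hadj'.reachable, fun h => h.trans hadj'.symm.reachable⟩
  have hbS : ¬ S (toEdge b).1 ∧ ¬ S (toEdge b).2.1 := by
    have h1 := hside b (by simp)
    rcases hbv with h2 | h2
    · exact ⟨h2 ▸ hvS, fun h3 => hvS (h2 ▸ h1.2 h3)⟩
    · exact ⟨fun h3 => hvS (h2 ▸ h1.1 h3), h2 ▸ hvS⟩
  obtain ⟨u', t', h1⟩ := commEquiv_adjacent hw S (by rwa [hai]) hbS
    (fun g hg => hside g (by simp [hg])) (fun g hg => by rw [hai]; exact hm g hg)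
  exact hirr u' a b t' rs h1 hrs

theorem commEquiv_of_sorted {l' l : List (Edge n)} (hp : l.Perm l') (hs : l'.Pairwise LexLE)
    (hv : ∀ e ∈ l, Valid e) (hn : l.Nodup)
    (hl : l.Pairwise fun e f => Apart e f ∨ LexLE e f) :
    CommEquiv (l.map edgeVar) (l'.map edgeVar) := by
  induction l' generalizing l with
  | nil => rw [hp.eq_nil]; exact .refl
  | cons e t ih =>
    obtain ⟨u, v, rfl⟩ := List.append_of_mem (hp.mem_iff.2 List.mem_cons_self)
    have hp' : (u ++ v).Perm t := (List.perm_cons e).1 (List.perm_middle.symm.trans hp)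
    rw [List.pairwise_cons] at hs
    have h1 : CommEquiv (edgeVar e :: u.map edgeVar) (u.map edgeVar ++ [edgeVar e]) := by
      refine commEquiv_cons_append fun g hg => ?_
      obtain ⟨f, hf, rfl⟩ := List.mem_map.1 hg
      have h2 : Apart f e := by
        rw [List.pairwise_append] at hl
        rw [List.nodup_append] at hn
        refine (hl.2.2 f hf e (by simp)).resolve_right fun h3 => ?_
        have h4 := hs.1 f (hp'.mem_iff.1 (by simp [hf]))
        exact hn.2.2 f hf e (by simp) (antisymm (r := LexLE) h3 h4)
      exact h2.symm.commute (hv e (by simp)) (hv f (by simp [hf]))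
    have h2 := h1.symm.append [] (v.map edgeVar)
    have hsub : (u ++ v).Sublist (u ++ e :: v) :=
      List.Sublist.append_left (List.sublist_cons_self e v) u
    have h3 := (ih hp' hs.2 (fun f hf => hv f (hsub.subset hf)) (hn.sublist hsub)
      (hl.sublist hsub)).append [edgeVar e] []
    simp only [List.map_append, List.map_cons, List.nil_append, List.append_nil,
      List.append_assoc, List.cons_append] at h2 h3 ⊢
    exact h2.trans h3

theorem Ascending.map {w : List (Gen n)} (h : Ascending w) : (w.map toEdge).map edgeVar = w := by
  rw [List.map_map]
  exact (List.map_congr_left h).trans w.map_id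

theorem Good.commEquiv_lexWord {w : List (Gen n)} (h : Good (w.map toEdge)) (hw : Ascending w)
    (ha : Alternating (w.map toEdge).toFinset) :
    CommEquiv w (lexWord (w.map toEdge).toFinset) := by
  have h1 : (w.map toEdge).Perm ((w.map toEdge).toFinset.sort LexLE) := by
    refine List.perm_of_nodup_nodup_toFinset_eq h.nodup (Finset.sort_nodup _ _) ?_
    simp
  have h2 := commEquiv_of_sorted h1 (Finset.pairwise_sort _ _) h.valid h.nodup ?_
  · rwa [hw.map] at h2
  · refine (List.pairwise_iff_forall_sublist.2 fun {e f} hef => ?_)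
    have hp := List.pairwise_iff_forall_sublist.1 h.prec hef
    have he : e ∈ w.map toEdge := hef.subset (by simp)
    have hf : f ∈ w.map toEdge := hef.subset (by simp)
    by_cases hc : ∃ v, (v = e.1 ∨ v = e.2.1) ∧ (v = f.1 ∨ v = f.2.1)
    · obtain ⟨v, h3, h4⟩ := hc
      right
      have := hp.2.2 v h3 h4
      rwa [if_pos (ha v e (by simpa using he) f (by simpa using hf) h3 h4)] at this
    · exact Or.inl (Or.inl ⟨fun h => hc ⟨_, Or.inl rfl, Or.inl h⟩,
        fun h => hc ⟨_, Or.inl rfl, Or.inr h⟩, fun h => hc ⟨_, Or.inr rfl, Or.inl h⟩,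
        fun h => hc ⟨_, Or.inr rfl, Or.inr h⟩⟩)

theorem Good.compat {es : List (Edge n)} (h : Good es) {e f : Edge n} (he : e ∈ es)
    (hf : f ∈ es) (hef : e ≠ f) : Compat e f := by
  have : es.Pairwise (fun e f => Compat e f ∧ Compat f e) := h.prec.imp fun h => ⟨h.1, h.2.1⟩
  have hsymm : Std.Symm (fun e f : Edge n => Compat e f ∧ Compat f e) := ⟨fun _ _ h => h.symm⟩
  exact (this.forall he hf hef).1

theorem Good.wellStructured {es : List (Edge n)} (h : Good es) : WellStructured es.toFinset := by
  have hc := fun {e f : Edge n} (he : e ∈ es) (hf : f ∈ es) => h.compat he hf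
  have hloop : (es.filter (fun e => decide (e.1 = e.2.1))).length = 1 := by
    rw [← List.countP_eq_length_filter, h.loops]
  obtain ⟨e₀, he₀⟩ := List.length_eq_one_iff.1 hloop
  have hmem : ∀ e, (e ∈ es ∧ e.1 = e.2.1) ↔ e = e₀ := by
    intro e
    have : e ∈ es.filter (fun e => decide (e.1 = e.2.1)) ↔ e = e₀ := by rw [he₀]; simp
    simpa using this
  have hv := h.valid
  refine ⟨⟨?_, ?_⟩, ?_, ?_, ?_, ?_, ?_, h.conn, ?_, ?_, h.isAcyclic⟩ <;>
    simp only [List.mem_toFinset]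
  · intro i j ε he
    exact (h.valid _ he).1
  · intro i ε he
    exact (h.valid _ he).2 rfl
  · rintro i j k l ε₁ ε₂ h1 h2 h3 ⟨h4, h5⟩
    exact (hc h4 h5 (by simp [h1.ne])).1 ⟨h1, h2, h3⟩
  · intro i j k l h1 h2 h3 h4
    by_cases hne : ((i, j, plus) : Edge n) = (k, l, plus)
    · simp only [Prod.mk.injEq] at hne
      obtain ⟨rfl, rfl, -⟩ := hne
      exact ⟨h3, h3⟩
    · exact (hc h1 h2 hne).2.1 rfl rfl h3 h4
  · intro i k l h1 h2 h3
    exact (hc h1 h2 (by rintro ⟨⟩; exact h3.false)).2.2.1 rfl rfl rfl h3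
  · rintro i k j h1 h2 ⟨h3, h4⟩
    exact (hc h3 h4 (by simp)).2.2.2.1 rfl rfl ⟨h1, h2⟩
  · rintro i j k l h1 h2 h3 ⟨h4, h5⟩
    exact (hc h4 h5 (by simp)).2.2.2.2 rfl rfl h2 ⟨h1, h3⟩
  · have h1 := (hmem e₀).2 rfl
    have h2 := (h.valid _ h1.1).2 h1.2
    obtain ⟨i, j, s⟩ := e₀
    simp only at h1 h2
    obtain ⟨h1, rfl⟩ := h1
    subst h2
    refine ⟨i, h1, fun k hk => ?_⟩
    have := (hmem (k, k, plus)).1 ⟨hk, rfl⟩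
    simpa using this
  · rintro i j h1 ⟨h2, h3⟩
    have hsymm : Std.Symm (Sep (n := n)) := ⟨fun _ _ h => h.symm⟩
    exact (h.sep.forall h2 h3 (by simp)).1 ⟨rfl, rfl⟩

theorem Good.mem_altWellStructured {w : List (Gen n)} (h : Good (w.map toEdge))
    (hw : Ascending w) (hirr : IrredWord w) :
    (w.map toEdge).toFinset ∈ altWellStructured n := by
  simp only [altWellStructured, Finset.mem_filter, Finset.mem_univ, true_and]
  exact ⟨h.wellStructured, h.alternating hw hirr⟩

/-! ### The Coxeter type element -/

/-- The edge list of the Coxeter type element: the path `1 - 2 - ⋯ - n` with a loop at `n`. -/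
def pathEdges (n : ℕ) (hn : 1 ≤ n) : List (Edge n) :=
  (List.finRange (n - 1)).map (fun i : Fin (n - 1) =>
    ((⟨i, by omega⟩, ⟨i + 1, by omega⟩, minus) : Edge n)) ++
  [(⟨n - 1, by omega⟩, ⟨n - 1, by omega⟩, plus)]

theorem coxeterWord_map_toEdge (hn : 1 ≤ n) : (coxeterWord n hn).map toEdge = pathEdges n hn := by
  simp [coxeterWord, pathEdges, toEdge, Function.comp_def, Fin.le_def]

theorem ascending_coxeterWord (hn : 1 ≤ n) : Ascending (coxeterWord n hn) := by
  intro g hg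
  simp only [coxeterWord, List.mem_append, List.mem_map, List.mem_singleton] at hg
  obtain ⟨i, -, rfl⟩ | rfl := hg
  · simp [toEdge, edgeVar, Fin.le_def]
  · simp [toEdge, edgeVar]

theorem good_pathEdges (hn : 1 ≤ n) : Good (pathEdges n hn) := by
  have hmem : ∀ k (hk : k + 1 < n),
      ((⟨k, by omega⟩, ⟨k + 1, hk⟩, minus) : Edge n) ∈ pathEdges n hn := by
    intro k hk
    simp only [pathEdges, List.mem_append, List.mem_map, List.mem_finRange, true_and]
    exact Or.inl ⟨⟨k, by omega⟩, rfl⟩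
  refine ⟨⟨?_, ?_, ?_, ?_⟩, ?_⟩
  · intro e he
    simp only [pathEdges, List.mem_append, List.mem_map, List.mem_singleton] at he
    obtain ⟨i, -, rfl⟩ | rfl := he <;> simp [Valid, Fin.le_def]
  · simp [pathEdges]; omega
  · simp [pathEdges, List.countP_append, List.countP_map, Function.comp_def]
  · have : Nonempty (Fin n) := ⟨⟨0, hn⟩⟩
    have hr : ∀ k (hk : k < n), (skeleton (pathEdges n hn).toFinset).Reachable ⟨0, hn⟩ ⟨k, hk⟩ := by
      intro k
      induction k with
      | zero => intro _; rfl
      | succ k ih =>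
        intro hk
        exact (ih (by omega)).trans (reachable_of_mem (List.mem_toFinset.2 (hmem k hk)))
    exact ⟨fun a b => (hr a a.2).symm.trans (hr b b.2)⟩
  · simp only [pathEdges, List.pairwise_append, List.pairwise_map, List.pairwise_singleton,
      List.mem_map, List.mem_singleton, true_and]
    constructor
    · refine (List.pairwise_lt_finRange (n - 1)).imp fun {i j} hij => ?_
      rw [Fin.lt_def] at hij
      simp only [Prec, Compat, inOrder_iff, LexLE, incSign, plus, minus, Fin.ext_iff, Fin.lt_def,
        Fin.le_def]
      grind
    · rintro _ ⟨i, -, rfl⟩ _ rfl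
      have := i.2
      simp only [Prec, Compat, inOrder_iff, LexLE, incSign, plus, minus, Fin.ext_iff, Fin.lt_def,
        Fin.le_def]
      grind

/-! ### Cones of edge lists -/

open scoped Pointwise

/-- The pairing of a functional `q` with the root `e_i + e_j` or `e_i - e_j` of an edge; the root of
the loop at `i` is `2 e_i`. -/
def pair {K : Type*} [Ring K] (q : Fin n → K) (e : Edge n) : K :=
  q e.1 + if e.2.2 = plus then q e.2.1 else -q e.2.1

/-- The root of an edge: `e_i + e_j` for a positive edge (hence `2 e_i` for a loop), and `e_i - e_j`
for a negative edge. -/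
def root (e : Edge n) : Fin n → ℝ :=
  Pi.single e.1 1 + if e.2.2 = plus then Pi.single e.2.1 1 else -Pi.single e.2.1 1

theorem sum_mul_root (q : Fin n → ℝ) (e : Edge n) : ∑ i, q i * root e i = pair q e := by
  unfold root pair
  split_ifs <;>
    simp [mul_add, Finset.sum_add_distrib, Pi.single_apply]

/-- The open ray spanned by the root of `e`. -/
def ray (e : Edge n) : Set (Fin n → ℝ) := {x | ∃ t : ℝ, 0 < t ∧ t • root e = x}

/-- The relatively open cone of positive combinations of the roots of the edges in a list. -/
def cone (es : List (Edge n)) : Set (Fin n → ℝ) := (es.map ray).sum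

theorem cone_nil : cone ([] : List (Edge n)) = 0 := rfl

theorem cone_cons (e : Edge n) (es : List (Edge n)) : cone (e :: es) = ray e + cone es := by
  simp [cone]

theorem cone_perm {es es' : List (Edge n)} (h : es.Perm es') : cone es = cone es' :=
  (h.map ray).sum_eq

theorem mem_cone_cons {e : Edge n} {es : List (Edge n)} {p : Fin n → ℝ} :
    p ∈ cone (e :: es) ↔ ∃ t : ℝ, 0 < t ∧ p - t • root e ∈ cone es := by
  rw [cone_cons, Set.mem_add]
  constructor
  · rintro ⟨_, ⟨t, ht, rfl⟩, r, hr, rfl⟩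
    exact ⟨t, ht, by simpa using hr⟩
  · rintro ⟨t, ht, hr⟩
    exact ⟨_, ⟨t, ht, rfl⟩, _, hr, by simp⟩

theorem mem_cone_single {u v : List (Edge n)} {e : Edge n} {p : Fin n → ℝ} :
    p ∈ cone (u ++ [e] ++ v) ↔ ∃ t : ℝ, 0 < t ∧ p - t • root e ∈ cone (u ++ v) := by
  rw [← mem_cone_cons]
  exact iff_of_eq (congrArg (p ∈ ·) (cone_perm (by simp)))

theorem mem_cone_pair {u v : List (Edge n)} {e f : Edge n} {p : Fin n → ℝ} :
    p ∈ cone (u ++ [e, f] ++ v) ↔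
      ∃ s t : ℝ, 0 < s ∧ 0 < t ∧ p - (s • root e + t • root f) ∈ cone (u ++ v) := by
  have h : (u ++ [e, f] ++ v).Perm (e :: f :: (u ++ v)) := by
    simpa using (List.perm_middle (a := e) (l₁ := u) (l₂ := f :: v)).trans
      (List.Perm.cons e List.perm_middle)
  rw [cone_perm h]
  simp only [mem_cone_cons, sub_sub]
  constructor
  · rintro ⟨s, hs, t, ht, h⟩
    exact ⟨s, t, hs, ht, h⟩
  · rintro ⟨s, t, hs, ht, h⟩
    exact ⟨s, hs, t, ht, h⟩

theorem cone_swap (u v : List (Edge n)) (e f : Edge n) :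
    cone (u ++ [e, f] ++ v) = cone (u ++ [f, e] ++ v) :=
  cone_perm (List.Perm.append_right _ (List.Perm.append_left _ (List.Perm.swap _ _ _)))

theorem convex_cone (es : List (Edge n)) : Convex ℝ (cone es) := by
  induction es with
  | nil => exact convex_zero
  | cons e es ih =>
    rw [cone_cons]
    refine Convex.add ?_ ih
    rintro _ ⟨s, hs, rfl⟩ _ ⟨t, ht, rfl⟩ a b ha hb hab
    refine ⟨a * s + b * t, ?_, by simp [add_smul, mul_smul]⟩
    rcases ha.eq_or_lt with rfl | ha
    · rw [zero_add] at hab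
      simpa [hab] using ht
    · positivity

theorem sum_mem_cone {es : List (Edge n)} {c : Edge n → ℝ} (hc : ∀ e ∈ es, 0 < c e) :
    (es.map fun e => c e • root e).sum ∈ cone es := by
  induction es with
  | nil => simp [cone_nil]
  | cons e es ih =>
    rw [mem_cone_cons]
    exact ⟨c e, hc e (by simp), by simpa using ih fun f hf => hc f (by simp [hf])⟩

theorem exists_coeff_of_mem_cone {es : List (Edge n)} (hn : es.Nodup) {p : Fin n → ℝ}
    (hp : p ∈ cone es) :
    ∃ c : Edge n → ℝ, (∀ e ∈ es, 0 < c e) ∧ (∀ e ∉ es, c e = 0) ∧ p = ∑ e, c e • root e := by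
  induction es generalizing p with
  | nil => exact ⟨0, by simp, by simp, by simpa [cone_nil] using hp⟩
  | cons f es ih =>
    obtain ⟨t, ht, h⟩ := mem_cone_cons.1 hp
    rw [List.nodup_cons] at hn
    obtain ⟨c, h1, h2, h3⟩ := ih hn.2 h
    refine ⟨fun e => c e + if e = f then t else 0, ?_, ?_, ?_⟩
    · intro e he
      rcases List.mem_cons.1 he with rfl | he
      · simpa [h2 e hn.1] using ht
      · have : e ≠ f := fun h => hn.1 (h ▸ he)
        simpa [this] using h1 e he
    · intro e he
      rw [List.mem_cons, not_or] at he
      simp [he.1, h2 e he.2]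
    · simp only [add_smul, Finset.sum_add_distrib, ← h3, ite_smul, zero_smul]
      simp

/-- A functional that is nonnegative on the roots of the edges is nonnegative on their cone. -/
theorem pairing_nonneg {es : List (Edge n)} {q p : Fin n → ℝ} (hq : ∀ e ∈ es, 0 ≤ pair q e)
    (hp : p ∈ cone es) : 0 ≤ ∑ i, q i * p i := by
  induction es generalizing p with
  | nil =>
    obtain rfl : p = 0 := by simpa [cone_nil] using hp
    simp
  | cons e es ih =>
    obtain ⟨t, ht, h⟩ := mem_cone_cons.1 hp
    have h1 := ih (fun f hf => hq f (by simp [hf])) h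
    have h2 : ∑ i, q i * (p - t • root e) i = ∑ i, q i * p i - t * pair q e := by
      simp only [Pi.sub_apply, Pi.smul_apply, smul_eq_mul, mul_sub, Finset.sum_sub_distrib,
        ← sum_mul_root, Finset.mul_sum]
      congr 1
      exact Finset.sum_congr rfl fun i _ => by ring
    have := mul_nonneg ht.le (hq e (by simp))
    linarith

/-! ### Generic points -/

/-- The coordinates of `p` are linearly independent over `ℚ`. -/
def Generic (p : Fin n → ℝ) : Prop := ∀ q : Fin n → ℚ, ∑ i, (q i : ℝ) * p i = 0 → q = 0

theorem pair_cast (q : Fin n → ℚ) (e : Edge n) :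
    pair (fun i => (q i : ℝ)) e = ((pair q e : ℚ) : ℝ) := by
  unfold pair
  split_ifs <;> simp

theorem pair_neg {K : Type*} [CommRing K] (q : Fin n → K) (e : Edge n) :
    pair (-q) e = -pair q e := by
  unfold pair
  split_ifs <;> simp <;> ring

/-- Fewer than `n` roots are orthogonal to a nonzero rational vector. -/
theorem Generic.notMem_cone {p : Fin n → ℝ} (hp : Generic p) {es : List (Edge n)}
    (h : es.length < n) : p ∉ cone es := by
  intro hmem
  let F : (Fin n → ℚ) →ₗ[ℚ] (Fin es.length → ℚ) :=
    { toFun := fun q k => pair q (es.get k)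
      map_add' := fun q q' => by
        ext k; simp only [pair, Pi.add_apply]; split_ifs <;> ring
      map_smul' := fun a q => by
        ext k; simp only [pair, Pi.smul_apply, smul_eq_mul, RingHom.id_apply]; split_ifs <;> ring }
  have hF : LinearMap.ker F ≠ ⊥ := LinearMap.ker_ne_bot_of_finrank_lt (by simpa using h)
  obtain ⟨q, hq, hq0⟩ := (Submodule.ne_bot_iff _).1 hF
  have hq' : ∀ e ∈ es, pair q e = 0 := by
    intro e he
    obtain ⟨k, rfl⟩ := List.get_of_mem he
    exact congrFun (LinearMap.mem_ker.1 hq) k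
  have h1 := pairing_nonneg (q := fun i => (q i : ℝ))
    (fun e he => by simp [pair_cast, hq' e he]) hmem
  have h2 := pairing_nonneg (q := -fun i => (q i : ℝ))
    (fun e he => by simp [pair_neg, pair_cast, hq' e he]) hmem
  simp only [Pi.neg_apply, neg_mul, Finset.sum_neg_distrib] at h2
  exact hq0 (hp q (by linarith))

theorem exists_linearIndependent_pos (ι : Type*) [Fintype ι] :
    ∃ c : ι → ℝ, LinearIndependent ℚ c ∧ ∀ i, 0 < c i := by
  have h1 : ((Fintype.card ι : ℕ) : Cardinal) ≤ Module.rank ℚ ℝ := by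
    rw [Real.rank_rat_real]
    exact Cardinal.natCast_lt_aleph0.le.trans Cardinal.aleph0_le_continuum
  obtain ⟨f, hf⟩ := exists_linearIndependent_of_le_rank h1
  let g : ι → ℝ := f ∘ Fintype.equivFin ι
  have hg : LinearIndependent ℚ g := hf.comp _ (Fintype.equivFin ι).injective
  let w : ι → ℚˣ := fun i => if 0 < g i then 1 else -1
  refine ⟨w • g, hg.units_smul w, fun i => ?_⟩
  have hne := hg.ne_zero i
  simp only [Pi.smul_apply', w]
  split_ifs with h
  · simpa using h
  · have : g i < 0 := lt_of_le_of_ne (not_lt.1 h) hne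
    simpa [Units.smul_def] using this

theorem exists_generic {G : Finset (Edge n)} (hconn : (skeleton G).Connected) {i₀ : Fin n}
    (hi₀ : (i₀, i₀, plus) ∈ G) : ∃ p, Generic p ∧ p ∈ cone (G.sort LexLE) := by
  obtain ⟨c, hc, hpos⟩ := exists_linearIndependent_pos (Edge n)
  refine ⟨((G.sort LexLE).map fun e => c e • root e).sum, ?_, sum_mem_cone fun e _ => hpos e⟩
  have hsum : ((G.sort LexLE).map fun e => c e • root e).sum = ∑ e ∈ G, c e • root e := by
    rw [← List.sum_toFinset _ (Finset.sort_nodup _ _), Finset.sort_toFinset]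
  intro q hq
  have h1 : ∑ e ∈ G, pair q e • c e = 0 := by
    rw [hsum] at hq
    rw [← hq]
    simp only [Finset.sum_apply, Pi.smul_apply, smul_eq_mul, Finset.mul_sum]
    rw [Finset.sum_comm]
    refine Finset.sum_congr rfl fun e _ => ?_
    rw [Rat.smul_def, ← pair_cast, ← sum_mul_root, Finset.sum_mul]
    exact Finset.sum_congr rfl fun i _ => by ring
  have h2 := linearIndependent_iff'.1 hc G _ h1
  have h3 : q i₀ = 0 := by
    have := h2 _ hi₀
    simp only [pair, if_true] at this
    linarith
  have h4 : ∀ u v, (skeleton G).Reachable u v → (q u = 0 → q v = 0) := by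
    rintro u v ⟨w⟩
    induction w with
    | nil => exact id
    | cons hadj _ ih =>
      refine fun h => ih ?_
      rcases (skeleton_adj.1 hadj).2 with ⟨ε, he⟩ | ⟨ε, he⟩ <;>
      · have := h2 _ he
        cases ε <;> simp [pair] at this <;> linarith
  funext v
  exact h4 i₀ v (hconn.preconnected i₀ v) h3

/-- The cone of the path with a loop is cut out by the partial sums of the coordinates, which are
nonnegative on the root of each edge. -/
theorem Generic.mem_cone_pathEdges {p : Fin n → ℝ} (hp : Generic p) (hn : 1 ≤ n)
    {es : List (Edge n)} (hv : ∀ e ∈ es, Valid e) (hmem : p ∈ cone es) :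
    p ∈ cone (pathEdges n hn) := by
  let H : Fin n → ℝ := fun k => ∑ i, (if i ≤ k then 1 else 0) * p i
  have hH : ∀ k, 0 < H k := by
    intro k
    refine lt_of_le_of_ne (pairing_nonneg (fun e he => ?_) hmem) fun h => ?_
    · have := (hv e he).1
      simp only [pair]
      split_ifs with h1 h2 h3 h2 h3 h4 h5
      all_goals first | (norm_num; done) | exact absurd (this.trans (by assumption)) h1
    · have h1 := hp (fun i => if i ≤ k then 1 else 0) (by
        rw [h]
        exact Finset.sum_congr rfl fun i _ => by split_ifs <;> simp)
      simpa using congrFun h1 k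
  obtain ⟨m, rfl⟩ : ∃ m, n = m + 1 := ⟨n - 1, by omega⟩
  let c : Edge (m + 1) → ℝ := fun e => if e.1 = e.2.1 then H e.1 / 2 else H e.1
  have hsum : p = ((pathEdges (m + 1) hn).map fun e => c e • root e).sum := by
    simp only [pathEdges, Nat.add_sub_cancel, List.map_append, List.map_map, List.map_cons,
      List.map_nil, List.sum_append, List.sum_singleton, Function.comp_def]
    rw [← Fin.sum_univ_def]
    change p = ∑ k : Fin m, c (k.castSucc, k.succ, minus) • root (k.castSucc, k.succ, minus) +
      c (Fin.last m, Fin.last m, plus) • root (Fin.last m, Fin.last m, plus)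
    have h1 : ∀ k : Fin m, c (k.castSucc, k.succ, minus) • root (k.castSucc, k.succ, minus) =
        H k.castSucc • Pi.single k.castSucc 1 - H k.castSucc • Pi.single k.succ 1 := fun k => by
      simp [root, c, Fin.castSucc_lt_succ.ne, sub_eq_add_neg]
    have h2 : c (Fin.last m, Fin.last m, plus) • root (Fin.last m, Fin.last m, plus) =
        H (Fin.last m) • Pi.single (Fin.last m) 1 := by
      simp only [root, c, if_true]
      rw [← two_smul ℝ, smul_smul]
      simp
    have h3 : (∑ k : Fin m, H k.castSucc • (Pi.single k.castSucc 1 : Fin (m + 1) → ℝ)) +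
        H (Fin.last m) • Pi.single (Fin.last m) 1 = H := by
      rw [← Fin.sum_univ_castSucc (fun k => H k • (Pi.single k 1 : Fin (m + 1) → ℝ))]
      ext i
      simp [Finset.sum_apply, Pi.single_apply]
    have h4 : p = H - ∑ k : Fin m, H k.castSucc • (Pi.single k.succ 1 : Fin (m + 1) → ℝ) := by
      ext i
      refine Fin.cases ?_ (fun j => ?_) i
      · simp [H, Finset.sum_apply, Fin.succ_ne_zero, eq_comm]
      · have h5 : H j.succ = H j.castSucc + p j.succ := by
          simp only [H]
          rw [← Finset.sum_erase_add _ _ (Finset.mem_univ j.succ),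
            ← Finset.sum_erase_add _ (fun i => (if i ≤ j.castSucc then 1 else 0) * p i)
              (Finset.mem_univ j.succ)]
          simp only [le_refl, if_true, one_mul, Fin.succ_le_castSucc_iff, lt_irrefl, if_false,
            zero_mul, add_zero]
          congr 1
          refine Finset.sum_congr rfl fun i hi => ?_
          have h6 : i ≤ j.succ ↔ i ≤ j.castSucc := by
            have := Finset.ne_of_mem_erase hi
            simp only [Fin.le_def, Fin.ext_iff, ne_eq, Fin.val_succ, Fin.val_castSucc] at *
            omega
          simp only [h6]
        simp [Finset.sum_apply, Pi.single_apply, h5]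
    rw [h2, Finset.sum_congr rfl fun k _ => h1 k, Finset.sum_sub_distrib, sub_add_eq_add_sub, h3]
    exact h4
  rw [hsum]
  refine sum_mem_cone fun e _ => ?_
  simp only [c]
  split_ifs
  · exact half_pos (hH _)
  · exact hH _

/-! ### Reductions subdivide cones -/

open scoped Pointwise

open Classical in
/-- The number `1` or `0` according to whether `P` holds. -/
noncomputable def ind (P : Prop) : ℕ := if P then 1 else 0

/-- Two points of a convex set on different sides of a line through the origin give a point of the
set on the line. -/
theorem exists_tie {V : Type*} [AddCommGroup V] [Module ℝ V] {R : Set V} (hR : Convex ℝ R)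
    {p a b : V} {k s t s' t' : ℝ} (hs : 0 < s) (hs' : 0 < s')
    (h : p - (s • a + t • b) ∈ R) (h' : p - (s' • a + t' • b) ∈ R) (h1 : k * t < s)
    (h2 : s' < k * t') : ∃ s'' t'' : ℝ, 0 < s'' ∧ s'' = k * t'' ∧
      p - (s'' • a + t'' • b) ∈ R := by
  have hd : 0 < (k * t' - s') + (s - k * t) := by linarith
  have hx : 0 < (k * t' - s') / ((k * t' - s') + (s - k * t)) := div_pos (by linarith) hd
  have hy : 0 < (s - k * t) / ((k * t' - s') + (s - k * t)) := div_pos (by linarith) hd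
  have hxy : (k * t' - s') / ((k * t' - s') + (s - k * t)) +
      (s - k * t) / ((k * t' - s') + (s - k * t)) = 1 := by
    rw [← add_div, div_self hd.ne']
  have hxy' : (k * t' - s') / ((k * t' - s') + (s - k * t)) * (s - k * t) =
      (s - k * t) / ((k * t' - s') + (s - k * t)) * (k * t' - s') := by ring
  set x := (k * t' - s') / ((k * t' - s') + (s - k * t))
  set y := (s - k * t) / ((k * t' - s') + (s - k * t))
  refine ⟨x * s + y * s', x * t + y * t', by positivity, by linear_combination hxy', ?_⟩
  have h3 := hR h h' hx.le hy.le hxy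
  have h4 : p = x • p + y • p := by rw [← add_smul, hxy, one_smul]
  have h5 : p - ((x * s + y * s') • a + (x * t + y * t') • b) =
      x • (p - (s • a + t • b)) + y • (p - (s' • a + t' • b)) := by
    nth_rw 1 [h4]
    module
  rwa [h5]

theorem ind_eq_one {P : Prop} (h : P) : ind P = 1 := if_pos h

theorem ind_eq_zero {P : Prop} (h : ¬ P) : ind P = 0 := if_neg h

/-- If `g` is the sum of the roots of `e` and `f`, then the hyperplane through `g` divides the cone
of `e, f, …` into the cones of `g, e, …` and `f, g, …`. -/
theorem Generic.ind_cone_two {p : Fin n → ℝ} (hp : Generic p) {u v : List (Edge n)}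
    {e f g : Edge n} (hl : (u ++ [e, f] ++ v).length = n) (hg : root g = root e + root f) :
    ind (p ∈ cone (u ++ [g, e] ++ v)) + ind (p ∈ cone (u ++ [f, g] ++ v)) =
      ind (p ∈ cone (u ++ [e, f] ++ v)) := by
  have htie : ∀ s t : ℝ, 0 < s → s = 1 * t → p - (s • root e + t • root f) ∉ cone (u ++ v) := by
    intro s t hs hst hmem
    refine hp.notMem_cone (es := u ++ [g] ++ v) (by simp at hl ⊢; omega)
      (mem_cone_single.2 ⟨s, hs, ?_⟩)
    rw [hg, smul_add]
    nth_rw 2 [hst]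
    rwa [one_mul]
  have h1 : p ∈ cone (u ++ [g, e] ++ v) ↔ ∃ s t : ℝ, 0 < t ∧ 1 * t < s ∧
      p - (s • root e + t • root f) ∈ cone (u ++ v) := by
    rw [mem_cone_pair]
    constructor
    · rintro ⟨a, b, ha, hb, h⟩
      refine ⟨a + b, a, ha, by linarith, ?_⟩
      convert h using 2
      rw [hg]; module
    · rintro ⟨s, t, ht, hst, h⟩
      refine ⟨t, s - t, ht, by linarith, ?_⟩
      convert h using 2
      rw [hg]; module
  have h2 : p ∈ cone (u ++ [f, g] ++ v) ↔ ∃ s t : ℝ, 0 < s ∧ s < 1 * t ∧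
      p - (s • root e + t • root f) ∈ cone (u ++ v) := by
    rw [mem_cone_pair]
    constructor
    · rintro ⟨a, b, ha, hb, h⟩
      refine ⟨b, a + b, hb, by linarith, ?_⟩
      convert h using 2
      rw [hg]; module
    · rintro ⟨s, t, hs, hst, h⟩
      refine ⟨t - s, s, by linarith, hs, ?_⟩
      convert h using 2
      rw [hg]; module
  have h3 := mem_cone_pair (u := u) (v := v) (e := e) (f := f) (p := p)
  by_cases c1 : p ∈ cone (u ++ [g, e] ++ v)
  · obtain ⟨s, t, ht, hst, h⟩ := h1.1 c1
    have c2 : p ∉ cone (u ++ [f, g] ++ v) := by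
      rw [h2]
      rintro ⟨s', t', hs', hst', h'⟩
      obtain ⟨x, y, hx, hxy, hm⟩ :=
        exists_tie (convex_cone _) (by linarith) hs' h h' hst hst'
      exact htie x y hx hxy hm
    rw [ind_eq_one c1, ind_eq_zero c2, ind_eq_one (h3.2 ⟨s, t, by linarith, ht, h⟩)]
  · by_cases c2 : p ∈ cone (u ++ [f, g] ++ v)
    · obtain ⟨s, t, hs, hst, h⟩ := h2.1 c2
      rw [ind_eq_zero c1, ind_eq_one c2, ind_eq_one (h3.2 ⟨s, t, hs, by linarith, h⟩)]
    · have c3 : p ∉ cone (u ++ [e, f] ++ v) := by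
        rw [h3]
        rintro ⟨s, t, hs, ht, h⟩
        rcases lt_trichotomy s (1 * t) with h4 | h4 | h4
        · exact c2 (h2.2 ⟨s, t, hs, h4, h⟩)
        · exact htie s t hs h4 h
        · exact c1 (h1.2 ⟨s, t, ht, h4, h⟩)
      rw [ind_eq_zero c1, ind_eq_zero c2, ind_eq_zero c3]

/-- The two hyperplanes through `g = e + f` and `k = 2e + f` divide the cone of `e, f, …` into three
cones. -/
theorem Generic.ind_cone_three {p : Fin n → ℝ} (hp : Generic p) {u v : List (Edge n)}
    {e f g k : Edge n} (hl : (u ++ [e, f] ++ v).length = n) (hg : root g = root e + root f)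
    (hk : root k = root e + root g) :
    ind (p ∈ cone (u ++ [k, e] ++ v)) + ind (p ∈ cone (u ++ [g, k] ++ v)) +
      ind (p ∈ cone (u ++ [f, g] ++ v)) = ind (p ∈ cone (u ++ [e, f] ++ v)) := by
  have h1 := hp.ind_cone_two (u := u) (v := v) (e := e) (f := f) (g := g) hl hg
  have h2 := hp.ind_cone_two (u := u) (v := v) (e := e) (f := g) (g := k) (by simpa using hl) hk
  rw [h2, cone_swap u v e g, h1]

theorem Generic.ind_cone_reduce {p : Fin n → ℝ} (hp : Generic p) {u v : List (Edge n)}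
    {a b : Gen n} {rs : List (List (Gen n))} (hl : (u ++ [toEdge a, toEdge b] ++ v).length = n)
    (hr : ReductionRule a b rs) :
    (rs.map fun r => ind (p ∈ cone (u ++ r.map toEdge ++ v))).sum =
      ind (p ∈ cone (u ++ [toEdge a, toEdge b] ++ v)) := by
  cases hr with
  | @xx i j k h1 h2 | @xy i j k h1 h2 | @xyMax' i j k h1 h2 | @yxMax' i j k h1 h2 =>
    simp only [List.map_cons, List.map_nil, List.sum_cons, List.sum_nil, add_zero]
    refine hp.ind_cone_two hl ?_
    simp only [toEdge_x h1, toEdge_x h2, toEdge_x (h1.trans h2), toEdge_y h1, toEdge_y h2,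
      toEdge_y (h1.trans h2), root]
    simp
    try abel
  | @xx' i j k h1 h2 | @xy' i j k h1 h2 | @xyMax i j k h1 h2 | @yxMax i j k h1 h2 =>
    simp only [List.map_cons, List.map_nil, List.sum_cons, List.sum_nil, add_zero]
    rw [add_comm]
    refine hp.ind_cone_two hl ?_
    simp only [toEdge_x h1, toEdge_x h2, toEdge_x (h1.trans h2), toEdge_y h1, toEdge_y h2,
      toEdge_y (h1.trans h2), root]
    simp
    try abel
  | @xz i j h1 =>
    simp only [List.map_cons, List.map_nil, List.sum_cons, List.sum_nil, add_zero, ← add_assoc]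
    refine hp.ind_cone_three hl ?_ ?_ <;>
    · simp only [toEdge_x h1, toEdge_y h1, toEdge_z, root]
      simp
      try abel
  | @xz' i j h1 =>
    simp only [List.map_cons, List.map_nil, List.sum_cons, List.sum_nil, add_zero, ← add_assoc]
    rw [cone_swap u v (toEdge (.x i j h1.ne)) (toEdge (.z i)),
      cone_swap u v (toEdge (.z i)) (toEdge (.y i j h1.ne)),
      cone_swap u v (toEdge (.y i j h1.ne)) (toEdge (.z j)), cone_swap u v (toEdge (.z j)) (toEdge (.x i j h1.ne))]
    refine hp.ind_cone_three (by simpa using hl) ?_ ?_ <;>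
    · simp only [toEdge_x h1, toEdge_y h1, toEdge_z, root]
      simp
      try abel

/-! ### The cones of alternating well-structured graphs are disjoint -/

/-- The point `p` is the combination of the roots of the edges of the alternating well-structured
graph `G` with the coefficients `c`, which are positive on `G` and zero elsewhere. -/
structure Flow (p : Fin n → ℝ) (G : Finset (Edge n)) (c : Edge n → ℝ) : Prop where
  ws : WellStructured G
  alt : Alternating G
  pos : ∀ e ∈ G, 0 < c e
  zero : ∀ e ∉ G, c e = 0
  sum : p = ∑ e, c e • root e

theorem root_apply_pos {e : Edge n} {v : Fin n} (he : Valid e) (hv : v = e.1 ∨ v = e.2.1)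
    (hs : incSign e v = plus) : 0 < root e v := by
  obtain ⟨i, j, s⟩ := e
  cases s <;> simp only [Valid, incSign, root, plus, minus, Pi.add_apply, Pi.neg_apply,
    Pi.single_apply, Bool.false_eq_true, if_false, if_true] at * <;> grind

theorem root_apply_neg {e : Edge n} {v : Fin n} (hv : v = e.1 ∨ v = e.2.1)
    (hs : incSign e v = minus) : root e v < 0 := by
  obtain ⟨i, j, s⟩ := e
  cases s
  · simp only [incSign, root, plus, minus, Pi.add_apply, Pi.neg_apply, Pi.single_apply,
      Bool.false_eq_true, if_false] at *
    grind
  · simp [incSign] at hs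

theorem root_apply_zero {e : Edge n} {v : Fin n} (hv : ¬ (v = e.1 ∨ v = e.2.1)) :
    root e v = 0 := by
  obtain ⟨i, j, s⟩ := e
  cases s <;> simp only [root, plus, Pi.add_apply, Pi.neg_apply, Pi.single_apply, Bool.false_eq_true,
    if_false, if_true] at * <;> grind

variable {p : Fin n → ℝ} {G G' : Finset (Edge n)} {c c' : Edge n → ℝ}

theorem WellStructured.valid (h : WellStructured G) {e : Edge n} (he : e ∈ G) : Valid e :=
  ⟨h.signed.1 _ _ _ he, fun h1 => by
    obtain ⟨i, j, s⟩ := e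
    obtain rfl : i = j := h1
    exact h.signed.2 _ _ he⟩

theorem Flow.nonneg (h : Flow p G c) (e : Edge n) : 0 ≤ c e := by
  by_cases he : e ∈ G
  · exact (h.pos e he).le
  · exact (h.zero e he).ge

theorem Flow.mem_of_lt (h : Flow p G c) {e : Edge n} {x : ℝ} (hx : 0 ≤ x) (he : x < c e) :
    e ∈ G := by
  by_contra h1
  rw [h.zero e h1] at he
  linarith

theorem Flow.apply (h : Flow p G c) (v : Fin n) : p v = ∑ e, c e * root e v := by
  rw [h.sum]
  simp

theorem Flow.apply_pos (h : Flow p G c) {e : Edge n} (he : e ∈ G) {v : Fin n}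
    (hv : v = e.1 ∨ v = e.2.1) (hs : incSign e v = plus) : 0 < p v := by
  rw [h.apply]
  refine Finset.sum_pos' (fun f _ => ?_)
    ⟨e, Finset.mem_univ e, mul_pos (h.pos e he) (root_apply_pos (h.ws.valid he) hv hs)⟩
  by_cases hf : f ∈ G
  · by_cases hfv : v = f.1 ∨ v = f.2.1
    · have := h.alt v e he f hf hv hfv
      exact (mul_pos (h.pos f hf) (root_apply_pos (h.ws.valid hf) hfv (this ▸ hs))).le
    · simp [root_apply_zero hfv]
  · simp [h.zero f hf]

theorem Flow.apply_neg (h : Flow p G c) {e : Edge n} (he : e ∈ G) {v : Fin n}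
    (hv : v = e.1 ∨ v = e.2.1) (hs : incSign e v = minus) : p v < 0 := by
  rw [h.apply, ← neg_pos, ← Finset.sum_neg_distrib]
  refine Finset.sum_pos' (fun f _ => ?_) ⟨e, Finset.mem_univ e,
    neg_pos.2 (mul_neg_of_pos_of_neg (h.pos e he) (root_apply_neg hv hs))⟩
  by_cases hf : f ∈ G
  · by_cases hfv : v = f.1 ∨ v = f.2.1
    · have := h.alt v e he f hf hv hfv
      exact (neg_pos.2 (mul_neg_of_pos_of_neg (h.pos f hf)
        (root_apply_neg hfv (this ▸ hs)))).le
    · simp [root_apply_zero hfv]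
  · simp [h.zero f hf]

theorem Flow.incSign_eq (h : Flow p G c) (h' : Flow p G' c') {e f : Edge n} (he : e ∈ G)
    (hf : f ∈ G') {v : Fin n} (hev : v = e.1 ∨ v = e.2.1) (hfv : v = f.1 ∨ v = f.2.1) :
    incSign e v = incSign f v := by
  cases h1 : incSign e v <;> cases h2 : incSign f v
  · rfl
  · exact absurd (h.apply_neg he hev h1) (h'.apply_pos hf hfv h2).le.not_gt
  · exact absurd (h'.apply_neg hf hfv h2) (h.apply_pos he hev h1).le.not_gt
  · rfl

/-- If the coefficient of an edge at `v` decreases, then the coefficient of another edge at `v`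
increases. -/
theorem Flow.exchange (h : Flow p G c) (h' : Flow p G' c') {e : Edge n} (he : c' e < c e)
    {v : Fin n} (hv : v = e.1 ∨ v = e.2.1) :
    ∃ f ∈ G', c f < c' f ∧ (v = f.1 ∨ v = f.2.1) ∧ incSign e v = incSign f v := by
  have heG : e ∈ G := h.mem_of_lt (h'.nonneg e) he
  suffices ∃ f, c f < c' f ∧ (v = f.1 ∨ v = f.2.1) by
    obtain ⟨f, hf, hfv⟩ := this
    have hfG := h'.mem_of_lt (h.nonneg f) hf
    exact ⟨f, hfG, hf, hfv, h.incSign_eq h' heG hfG hv hfv⟩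
  by_contra! hno
  have hsign : ∀ f, c' f < c f → (v = f.1 ∨ v = f.2.1) → incSign f v = incSign e v :=
    fun f hf hfv => h.alt v f (h.mem_of_lt (h'.nonneg f) hf) e heG hfv hv
  have hsum : ∑ f, (c f - c' f) * root f v = 0 := by
    simp only [sub_mul, Finset.sum_sub_distrib, ← h.apply, ← h'.apply, sub_self]
  cases hs : incSign e v
  · refine absurd hsum (ne_of_lt ?_)
    rw [← neg_pos, ← Finset.sum_neg_distrib]
    refine Finset.sum_pos' (fun f _ => ?_) ⟨e, Finset.mem_univ e,
      neg_pos.2 (mul_neg_of_pos_of_neg (sub_pos.2 he) (root_apply_neg hv hs))⟩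
    by_cases hfv : v = f.1 ∨ v = f.2.1
    · have h1 : c' f ≤ c f := not_lt.1 fun h2 => by have := hno f h2; tauto
      rcases h1.eq_or_lt with h1 | h1
      · simp [h1]
      · exact (neg_pos.2 (mul_neg_of_pos_of_neg (sub_pos.2 h1)
          (root_apply_neg hfv ((hsign f h1 hfv).trans hs)))).le
    · simp [root_apply_zero hfv]
  · refine absurd hsum (ne_of_gt ?_)
    refine Finset.sum_pos' (fun f _ => ?_) ⟨e, Finset.mem_univ e,
      mul_pos (sub_pos.2 he) (root_apply_pos (h.ws.valid heG) hv hs)⟩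
    by_cases hfv : v = f.1 ∨ v = f.2.1
    · have h1 : c' f ≤ c f := not_lt.1 fun h2 => by have := hno f h2; tauto
      rcases h1.eq_or_lt with h1 | h1
      · simp [h1]
      · exact (mul_pos (sub_pos.2 h1)
          (root_apply_pos (h.ws.valid (h.mem_of_lt (h'.nonneg f) h1)) hfv ((hsign f h1 hfv).trans hs))).le
    · simp [root_apply_zero hfv]

/-- A shortest negative edge `(i, j)` with `c ≠ c'` gives edges of `G'` at `i` and at `j` that
cross, or are nested in a forbidden way. -/
theorem Flow.no_negative (h : Flow p G c) (h' : Flow p G' c') {i j : Fin n}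
    (he : c' (i, j, minus) < c (i, j, minus))
    (hmin : ∀ k l, k ≤ l → c' (k, l, minus) ≠ c (k, l, minus) →
      (j : ℤ) - i ≤ (l : ℤ) - k) : False := by
  have hij : i < j := by
    have := h.ws.valid (h.mem_of_lt (h'.nonneg _) he)
    simp only [Valid, plus, minus] at this
    grind
  obtain ⟨⟨k, l, s⟩, hfG, hf, hfv, hfs⟩ := h.exchange h' he (v := j) (Or.inr rfl)
  have hf' : s = minus ∧ l = j := by
    simp only [incSign, plus, minus] at *
    grind
  obtain ⟨rfl, rfl⟩ := hf'
  have hki : k < i := by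
    have h1 := hmin k l (h'.ws.valid hfG).1 hf.ne'
    have h2 : k ≠ i := by rintro rfl; exact lt_asymm he hf
    have h3 : (k : ℕ) ≠ i := fun h => h2 (Fin.ext h)
    rw [Fin.lt_def]
    omega
  obtain ⟨⟨a, b, t⟩, hgG, hg, hgv, hgs⟩ := h.exchange h' he (v := i) (Or.inl rfl)
  have hab := (h'.ws.valid hgG).1
  simp only at hab hgv
  cases t
  · have ha : a = i := by
      simp only [incSign, plus, minus] at *
      grind
    subst ha
    have h1 := hmin a b hab hg.ne'
    have h2 : b ≠ l := by rintro rfl; exact lt_asymm he hg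
    have h3 : (b : ℕ) ≠ l := fun h => h2 (Fin.ext h)
    exact h'.ws.noncrossing k a l b _ _ hki hij (by rw [Fin.lt_def]; omega) ⟨hfG, hgG⟩
  · rcases hab.eq_or_lt with rfl | hab
    · obtain rfl : i = a := by tauto
      exact h'.ws.loop_neg i k l hki hij ⟨hgG, hfG⟩
    · rcases hgv with rfl | rfl
      · rcases le_or_gt b l with h1 | h1
        · exact h'.ws.pos_neg i b k l hki.le hab h1 ⟨hgG, hfG⟩
        · exact h'.ws.noncrossing k i l b _ _ hki hij h1 ⟨hfG, hgG⟩
      · rcases lt_or_ge a k with h1 | h1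
        · exact h'.ws.noncrossing a k i l _ _ h1 hki hij ⟨hgG, hfG⟩
        · exact h'.ws.pos_neg a i k l h1 hab hij.le ⟨hgG, hfG⟩

/-- If `c = c'` on negative edges, a longest positive edge `(i, j)` with `c ≠ c'` gives edges of
`G'` at `i` and at `j` that cross or have disjoint interiors. -/
theorem Flow.no_positive (h : Flow p G c) (h' : Flow p G' c') {i j : Fin n} (hij : i < j)
    (he : c' (i, j, plus) < c (i, j, plus))
    (hneg : ∀ k l, c' (k, l, minus) = c (k, l, minus))
    (hmax : ∀ k l, k ≤ l → c' (k, l, plus) ≠ c (k, l, plus) →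
      (l : ℤ) - k ≤ (j : ℤ) - i) : False := by
  obtain ⟨⟨a, b, s⟩, hfG, hf, hfv, hfs⟩ := h.exchange h' he (v := i) (Or.inl rfl)
  obtain ⟨⟨k, l, t⟩, hgG, hg, hgv, hgs⟩ := h.exchange h' he (v := j) (Or.inr rfl)
  cases s
  · exact hf.ne (hneg a b).symm
  cases t
  · exact hg.ne (hneg k l).symm
  have hab := (h'.ws.valid hfG).1
  have hkl := (h'.ws.valid hgG).1
  have h1 := hmax a b hab hf.ne'
  have h2 := hmax k l hkl hg.ne'
  have h3 : ¬ (a = i ∧ b = j) := by rintro ⟨rfl, rfl⟩; exact lt_asymm he hf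
  have h4 : ¬ (k = i ∧ l = j) := by rintro ⟨rfl, rfl⟩; exact lt_asymm he hg
  have c1 := h'.ws.pos_pos a b k l hfG hgG
  have c2 : a = b → k < l → k ≤ a ∧ a ≤ l := by rintro rfl; exact h'.ws.loop_pos a k l hfG hgG
  have c3 : k = l → a < b → a ≤ k ∧ k ≤ b := by rintro rfl; exact h'.ws.loop_pos k a b hgG hfG
  have c4 : a = b → k = l → a = k := by
    rintro rfl rfl; exact h'.ws.one_loop.unique hfG hgG
  have c5 : ¬ (a < k ∧ k < b ∧ b < l) := fun ⟨x, y, z⟩ =>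
    h'.ws.noncrossing a k b l _ _ x y z ⟨hfG, hgG⟩
  simp only [Fin.lt_def, Fin.le_def, Fin.ext_iff] at *
  rcases hfv with hfv | hfv <;> rcases hgv with hgv | hgv <;> omega

theorem Flow.coeff_eq (h : Flow p G c) (h' : Flow p G' c') : c = c' := by
  classical
  have hv : ∀ e, c' e ≠ c e → e.1 ≤ e.2.1 := by
    intro e he
    rcases lt_or_gt_of_ne he with h1 | h1
    · exact (h.ws.valid (h.mem_of_lt (h'.nonneg _) h1)).1
    · exact (h'.ws.valid (h'.mem_of_lt (h.nonneg _) h1)).1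
  have hneg : ∀ k l, c' (k, l, minus) = c (k, l, minus) := by
    by_contra! hne
    obtain ⟨k, l, hkl⟩ := hne
    obtain ⟨⟨i, j⟩, h1, h2⟩ := Finset.exists_min_image
      (Finset.univ.filter fun x : Fin n × Fin n => c' (x.1, x.2, minus) ≠ c (x.1, x.2, minus))
      (fun x => (x.2 : ℤ) - x.1) ⟨(k, l), by simpa using hkl⟩
    simp only [Finset.mem_filter, Finset.mem_univ, true_and, Prod.forall] at h1 h2
    rcases lt_or_gt_of_ne h1 with h3 | h3
    · exact h.no_negative h' h3 fun k l _ => h2 k l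
    · exact h'.no_negative h h3 fun k l _ h4 => h2 k l h4.symm
  have hpos : ∀ k l, k < l → c' (k, l, plus) = c (k, l, plus) := by
    by_contra! hne
    obtain ⟨k, l, hkl, hne⟩ := hne
    obtain ⟨⟨i, j⟩, h1, h2⟩ := Finset.exists_max_image
      (Finset.univ.filter fun x : Fin n × Fin n =>
        c' (x.1, x.2, plus) ≠ c (x.1, x.2, plus) ∧ x.1 ≤ x.2)
      (fun x => (x.2 : ℤ) - x.1) ⟨(k, l), by simpa using ⟨hne, hkl.le⟩⟩
    have h0 := h2 (k, l) (by simpa using ⟨hne, hkl.le⟩)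
    simp only [Finset.mem_filter, Finset.mem_univ, true_and, Prod.forall] at h0 h1 h2
    have hij : i < j := by
      rw [Fin.lt_def] at hkl ⊢
      omega
    rcases lt_or_gt_of_ne h1.1 with h3 | h3
    · exact h.no_positive h' hij h3 hneg fun k l h4 h5 => h2 k l ⟨h5, h4⟩
    · exact h'.no_positive h hij h3 (fun k l => (hneg k l).symm)
        fun k l h4 h5 => h2 k l ⟨h5.symm, h4⟩
  have hloop : ∀ {G G' : Finset (Edge n)} {c c' : Edge n → ℝ}, Flow p G c → Flow p G' c' →
      (∀ k l, c' (k, l, minus) = c (k, l, minus)) →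
      (∀ k l, k < l → c' (k, l, plus) = c (k, l, plus)) →
      ∀ i, ¬ c' (i, i, plus) < c (i, i, plus) := by
    intro G G' c c' h h' hneg hpos i hi
    obtain ⟨⟨a, b, s⟩, hfG, hf, hfv, -⟩ := h.exchange h' hi (v := i) (Or.inl rfl)
    cases s
    · exact hf.ne (hneg a b).symm
    · rcases (h'.ws.valid hfG).1.eq_or_lt with h1 | h1
      · obtain rfl : a = b := h1
        obtain rfl : i = a := by tauto
        exact lt_asymm hi hf
      · exact hf.ne (hpos a b h1).symm
  funext e
  by_contra hne
  have hle := hv e (Ne.symm hne)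
  obtain ⟨i, j, s⟩ := e
  cases s
  · exact hne (hneg i j).symm
  · rcases hle.eq_or_lt with h1 | h1
    · obtain rfl : i = j := h1
      rcases lt_or_gt_of_ne hne with h2 | h2
      · exact hloop h' h (fun k l => (hneg k l).symm) (fun k l h => (hpos k l h).symm) i h2
      · exact hloop h h' hneg hpos i h2
    · exact hne (hpos i j h1).symm

theorem Flow.graph_eq (h : Flow p G c) (h' : Flow p G' c') : G = G' := by
  have hc := h.coeff_eq h'
  subst hc
  ext e
  constructor <;> intro he <;> by_contra h1
  · exact (h.pos e he).ne' (h'.zero e h1)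
  · exact (h'.pos e he).ne' (h.zero e h1)

theorem exists_flow (hG : G ∈ altWellStructured n) {es : List (Edge n)} (hn : es.Nodup)
    (hes : es.toFinset = G) (hp : p ∈ cone es) : ∃ c, Flow p G c := by
  simp only [altWellStructured, Finset.mem_filter, Finset.mem_univ, true_and] at hG
  obtain ⟨c, h1, h2, h3⟩ := exists_coeff_of_mem_cone hn hp
  subst hes
  exact ⟨c, hG.1, hG.2, by simpa using h1, by simpa using h2, h3⟩

/-- Each alternating well-structured graph has a generic point in its cone. -/
theorem exists_generic_flow (hG : G ∈ altWellStructured n) :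
    ∃ p c, Generic p ∧ p ∈ cone (G.sort LexLE) ∧ Flow p G c := by
  have h1 : WellStructured G := by
    simp only [altWellStructured, Finset.mem_filter, Finset.mem_univ, true_and] at hG
    exact hG.1
  obtain ⟨i, hi⟩ := h1.one_loop.exists
  obtain ⟨p, hp, hmem⟩ := exists_generic h1.connected hi
  obtain ⟨c, hc⟩ := exists_flow hG (Finset.sort_nodup _ _) (Finset.sort_toFinset _ _) hmem
  exact ⟨p, c, hp, hmem, hc⟩

/-! ### Reduction trees -/

theorem ReductionRule.length {a b : Gen n} {rs : List (List (Gen n))} (h : ReductionRule a b rs) :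
    ∀ r ∈ rs, r.length = 2 := by
  cases h <;> simp

theorem ReductionRule.ascending {a b : Gen n} {rs : List (List (Gen n))}
    (h : ReductionRule a b rs) : Ascending [a, b] ∧ ∀ r ∈ rs, Ascending r := by
  cases h with
  | @xx i j k h1 h2 | @xy i j k h1 h2 | @xyMax' i j k h1 h2 | @yxMax' i j k h1 h2
  | @xx' i j k h1 h2 | @xy' i j k h1 h2 | @xyMax i j k h1 h2 | @yxMax i j k h1 h2 =>
    have h3 := h1.trans h2
    simp [Ascending, toEdge, edgeVar, h1.le, h1.ne, h2.le, h2.ne, h3.le, h3.ne]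
  | @xz i j h1 | @xz' i j h1 => simp [Ascending, toEdge, edgeVar, h1.le, h1.ne]

theorem mem_sum_map {α β : Type*} {rs : List α} {L : α → Multiset β} {x : β} :
    x ∈ (rs.map L).sum ↔ ∃ r ∈ rs, x ∈ L r := by
  induction rs with
  | nil => simp
  | cons r rs ih => simp [ih]

theorem sum_map_sum_map {α β M : Type*} [AddCommMonoid M] (rs : List α) (L : α → Multiset β)
    (f : β → M) :
    ((rs.map L).sum.map f).sum = (rs.map fun r => ((L r).map f).sum).sum := by
  induction rs with
  | nil => simp
  | cons r rs ih => simp [ih]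

theorem HasLeaves.leaf_properties {w : List (Gen n)} {L : Multiset (List (Gen n))}
    (h : HasLeaves w L) (hg : Good (w.map toEdge)) (hw : Ascending w) :
    ∀ l ∈ L, Good (l.map toEdge) ∧ Ascending l ∧ IrredWord l := by
  induction h with
  | leaf w h =>
    intro l hl
    obtain rfl := Multiset.mem_singleton.1 hl
    exact ⟨hg, hw, h⟩
  | node w u v a b rs L hwc hr _ ih =>
    intro l hl
    obtain ⟨r, hrs, hl⟩ := mem_sum_map.1 hl
    refine ih r hrs ?_ ?_ l hl
    · have h1 := hg.commEquiv hwc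
      simp only [List.map_append, List.map_cons, List.map_nil] at h1 ⊢
      exact h1.reduce hr r hrs
    · intro g hgm
      have h1 : ∀ g ∈ u ++ [a, b] ++ v, edgeVar (toEdge g) = g :=
        fun g hg => hw g (hwc.perm.mem_iff.2 hg)
      simp only [List.mem_append] at hgm h1
      rcases hgm with (hgm | hgm) | hgm
      · exact h1 g (by tauto)
      · exact hr.ascending.2 r hrs g hgm
      · exact h1 g (by tauto)

/-- The number of leaves whose cone contains a generic point `p` is `1` or `0`, according to whether
the cone of the root contains `p`. -/
theorem HasLeaves.sum_ind_cone {w : List (Gen n)} {L : Multiset (List (Gen n))}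
    (h : HasLeaves w L) {p : Fin n → ℝ} (hp : Generic p) (hl : w.length = n) :
    (L.map fun l => ind (p ∈ cone (l.map toEdge))).sum = ind (p ∈ cone (w.map toEdge)) := by
  induction h with
  | leaf w h => simp
  | node w u v a b rs L hwc hr _ ih =>
    have h1 : (u ++ [a, b] ++ v).length = n := by rw [← hwc.perm.length_eq, hl]
    have h2 := hp.ind_cone_reduce (u := u.map toEdge) (v := v.map toEdge)
      (by simpa using h1) hr
    rw [cone_perm (hwc.perm.map toEdge), sum_map_sum_map]
    simp only [List.map_append, List.map_cons, List.map_nil]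
    rw [← h2]
    congr 1
    refine List.map_congr_left fun r hrs => ?_
    rw [ih r hrs]
    · simp
    · have := hr.length r hrs
      simp only [List.length_append, List.length_cons, List.length_nil] at h1 ⊢
      omega

/-- A measure that decreases under reductions: `2 n` minus the value at the root of the edge of the
linear form `e_i ↦ n - i`. This form is positive on the roots of all edges, so the third edge of a
reduction, whose root is a sum, has smaller weight than both reduced edges. -/
def weight (g : Gen n) : ℕ :=
  if (toEdge g).2.2 = plus then (toEdge g).1 + (toEdge g).2.1
  else 2 * n + (toEdge g).1 - (toEdge g).2.1

theorem ReductionRule.weight_lt {a b : Gen n} {rs : List (List (Gen n))}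
    (h : ReductionRule a b rs) :
    ∀ r ∈ rs, (r.map weight).sum < weight a + weight b := by
  cases h with
  | @xx i j k h1 h2 | @xy i j k h1 h2 | @xyMax' i j k h1 h2 | @yxMax' i j k h1 h2
  | @xx' i j k h1 h2 | @xy' i j k h1 h2 | @xyMax i j k h1 h2 | @yxMax i j k h1 h2 =>
    have h3 := h1.trans h2
    have h4 := k.2
    simp only [List.mem_cons, List.not_mem_nil, or_false, forall_eq_or_imp, forall_eq,
      List.map_cons, List.map_nil, List.sum_cons, List.sum_nil, weight, toEdge_x h1,
      toEdge_x h2, toEdge_x h3, toEdge_y h1, toEdge_y h2, toEdge_y h3, plus, minus,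
      Bool.false_eq_true, if_true, if_false]
    rw [Fin.lt_def] at h1 h2
    omega
  | @xz i j h1 | @xz' i j h1 =>
    have h4 := j.2
    simp only [List.mem_cons, List.not_mem_nil, or_false, forall_eq_or_imp, forall_eq,
      List.map_cons, List.map_nil, List.sum_cons, List.sum_nil, weight, toEdge_x h1,
      toEdge_y h1, toEdge_z, plus, minus, Bool.false_eq_true, if_true, if_false]
    rw [Fin.lt_def] at h1
    omega

theorem exists_hasLeaves (w : List (Gen n)) : ∃ L, HasLeaves w L := by
  classical
  induction hm : (w.map weight).sum using Nat.strong_induction_on generalizing w with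
  | _ m ih =>
    by_cases hirr : IrredWord w
    · exact ⟨_, .leaf w hirr⟩
    · simp only [IrredWord, not_forall, not_not] at hirr
      obtain ⟨u, a, b, v, rs, hw, hr⟩ := hirr
      have h1 : ∀ r ∈ rs, ∃ L, HasLeaves (u ++ r ++ v) L := by
        intro r hrs
        refine ih _ ?_ _ rfl
        rw [← hm, (hw.perm.map weight).sum_eq]
        have := hr.weight_lt r hrs
        simp only [List.map_append, List.sum_append, List.map_cons, List.map_nil, List.sum_cons,
          List.sum_nil]
        omega
      choose L hL using h1
      refine ⟨_, .node w u v a b rs (fun r => if h : r ∈ rs then L r h else 0) hw hr ?_⟩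
      intro r hrs
      simpa [hrs] using hL r hrs

/-- Among the cones of irreducible words, that of `G` is the only one containing a given point of
it. -/
theorem mem_cone_iff_toFinset_eq {G : Finset (Edge n)} (hG : G ∈ altWellStructured n)
    {p : Fin n → ℝ} {c : Edge n → ℝ} (hp : p ∈ cone (G.sort LexLE)) (hc : Flow p G c)
    {w : List (Gen n)} (hg : Good (w.map toEdge)) (hw : Ascending w) (hirr : IrredWord w) :
    p ∈ cone (w.map toEdge) ↔ (w.map toEdge).toFinset = G := by
  constructor
  · intro h
    obtain ⟨c', hc'⟩ := exists_flow (hg.mem_altWellStructured hw hirr) hg.nodup rfl h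
    exact hc'.graph_eq hc
  · rintro rfl
    rwa [cone_perm (List.perm_of_nodup_nodup_toFinset_eq hg.nodup (Finset.sort_nodup _ LexLE)
      (Finset.sort_toFinset _ _).symm)]

theorem Flow.mem_cone_coxeterWord {G : Finset (Edge n)} {p : Fin n → ℝ} {c : Edge n → ℝ}
    (hc : Flow p G c) (hgen : Generic p) (hp : p ∈ cone (G.sort LexLE)) (hn : 1 ≤ n) :
    p ∈ cone ((coxeterWord n hn).map toEdge) := by
  rw [coxeterWord_map_toEdge]
  exact hgen.mem_cone_pathEdges hn (fun e he => hc.ws.valid ((Finset.mem_sort _).1 he)) hp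

theorem good_coxeterWord (hn : 1 ≤ n) : Good ((coxeterWord n hn).map toEdge) :=
  coxeterWord_map_toEdge hn ▸ good_pathEdges hn

theorem length_coxeterWord (hn : 1 ≤ n) : (coxeterWord n hn).length = n := by
  rw [← List.length_map (f := toEdge)]
  exact (good_coxeterWord hn).length

theorem sum_ind_eq_count {α β : Type*} [DecidableEq β] (L : Multiset α) (f : α → β) (b : β) :
    (L.map fun a => ind (f a = b)).sum = (L.map f).count b := by
  induction L using Multiset.induction with
  | empty => simp
  | cons a L ih =>
    rw [Multiset.map_cons, Multiset.sum_cons, ih, Multiset.map_cons, Multiset.count_cons, add_comm]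
    by_cases h : f a = b
    · simp [ind, h]
    · simp [ind, h, Ne.symm h]

theorem HasLeaves.map_toFinset {hn : 1 ≤ n} {L : Multiset (List (Gen n))}
    (h : HasLeaves (coxeterWord n hn) L) :
    L.map (fun l => (l.map toEdge).toFinset) = (altWellStructured n).val := by
  have hL := h.leaf_properties (good_coxeterWord hn) (ascending_coxeterWord hn)
  refine Multiset.ext.2 fun G => ?_
  by_cases hG : G ∈ altWellStructured n
  · obtain ⟨p, c, hgen, hp, hc⟩ := exists_generic_flow hG
    rw [Multiset.count_eq_one_of_mem (Finset.nodup _) hG, ← sum_ind_eq_count]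
    have h1 := h.sum_ind_cone hgen (length_coxeterWord hn)
    rw [ind_eq_one (hc.mem_cone_coxeterWord hgen hp hn)] at h1
    rw [← h1]
    congr 1
    refine Multiset.map_congr rfl fun l hl => ?_
    obtain ⟨h2, h3, h4⟩ := hL l hl
    rw [mem_cone_iff_toFinset_eq hG hp hc h2 h3 h4]
  · rw [Multiset.count_eq_zero_of_notMem (show G ∉ (altWellStructured n).val from hG),
      Multiset.count_eq_zero]
    intro h1
    obtain ⟨l, hl, rfl⟩ := Multiset.mem_map.1 h1
    obtain ⟨h2, h3, h4⟩ := hL l hl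
    exact hG (h2.mem_altWellStructured h3 h4)

theorem HasLeaves.rel {hn : 1 ≤ n} {L : Multiset (List (Gen n))}
    (h : HasLeaves (coxeterWord n hn) L) :
    Multiset.Rel CommEquiv L ((altWellStructured n).val.map lexWord) := by
  rw [← h.map_toFinset, Multiset.map_map, Multiset.rel_map_right]
  refine Multiset.rel_refl_of_refl_on fun l hl => ?_
  obtain ⟨h2, h3, h4⟩ :=
    h.leaf_properties (good_coxeterWord hn) (ascending_coxeterWord hn) l hl
  exact h2.commEquiv_lexWord h3 (h2.alternating h3 h4)

/-! ### Signs of words -/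

/-- The sign relating a variable to the one with its indices in increasing order. -/
def genSign : Gen n → ℚ
  | .x i j _ => if i < j then 1 else -1
  | .y _ _ _ => 1
  | .z _ => 1

/-- The sign relating a word to its normal form `normalize w`. -/
def wordSign (w : List (Gen n)) : ℚ := (w.map genSign).prod

/-- The word with the indices of each `x_ij` and `y_ij` put into increasing order. -/
def normalize (w : List (Gen n)) : List (Gen n) := (w.map toEdge).map edgeVar

theorem genSign_mul_self (g : Gen n) : genSign g * genSign g = 1 := by
  cases g with
  | x i j h => simp only [genSign]; split_ifs <;> norm_num
  | y i j h => exact one_mul 1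
  | z i => exact one_mul 1

theorem wordSign_append (u v : List (Gen n)) : wordSign (u ++ v) = wordSign u * wordSign v := by
  simp [wordSign]

theorem wordSign_mul_self (w : List (Gen n)) : wordSign w * wordSign w = 1 := by
  induction w with
  | nil => simp [wordSign]
  | cons g w ih =>
    simp only [wordSign, List.map_cons, List.prod_cons] at *
    rw [mul_mul_mul_comm, genSign_mul_self, ih, one_mul]

theorem genSign_edgeVar {e : Edge n} (he : Valid e) : genSign (edgeVar e) = 1 := by
  obtain ⟨i, j, s⟩ := e
  rcases eq_or_lt_of_le he.1 with h | h
  · obtain rfl : i = j := h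
    simp [edgeVar, genSign]
  · replace h : i < j := h
    cases s <;> simp [edgeVar, genSign, h.ne, h]

theorem Ascending.wordSign {w : List (Gen n)} (h : Ascending w) : wordSign w = 1 := by
  induction w with
  | nil => simp [BracketC.wordSign]
  | cons g w ih =>
    have h1 : genSign g = 1 := by
      rw [← h g (by simp)]
      exact genSign_edgeVar (valid_toEdge g)
    have h2 := ih fun g hg => h g (by simp [hg])
    simp only [BracketC.wordSign, List.map_cons, List.prod_cons] at *
    rw [h1, h2, one_mul]

theorem normalize_append (u v : List (Gen n)) :
    normalize (u ++ v) = normalize u ++ normalize v := by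
  simp [normalize]

theorem normalize_map_toEdge (w : List (Gen n)) : (normalize w).map toEdge = w.map toEdge := by
  simp only [normalize, List.map_map]
  exact List.map_congr_left fun g _ => toEdge_edgeVar (valid_toEdge g)

theorem ascending_normalize (w : List (Gen n)) : Ascending (normalize w) := by
  intro g hg
  simp only [normalize, List.map_map, List.mem_map, Function.comp_apply] at hg
  obtain ⟨g, -, rfl⟩ := hg
  rw [toEdge_edgeVar (valid_toEdge g)]

theorem Ascending.normalize {w : List (Gen n)} (h : Ascending w) : normalize w = w := h.map

/-! ### Polynomials with nonnegative signed coefficients -/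

noncomputable instance : DecidableEq (Gen n) := Classical.decEq _

theorem coeffAt_add (P Q : NCPoly n) (w : List (Gen n)) :
    coeffAt (P + Q) w = coeffAt P w + coeffAt Q w := rfl

theorem coeffAt_smul (c : ℚ) (P : NCPoly n) (w : List (Gen n)) :
    coeffAt (c • P) w = c * coeffAt P w := rfl

theorem coeffAt_zero (w : List (Gen n)) : coeffAt (0 : NCPoly n) w = 0 := rfl

theorem coeffAt_mon (w w' : List (Gen n)) : coeffAt (mon w) w' = if w = w' then 1 else 0 := by
  classical
  simp only [coeffAt, mon, MonoidAlgebra.coeff_single, Finsupp.single_apply,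
    EmbeddingLike.apply_eq_iff_eq]

theorem mon_mul (u v : List (Gen n)) : mon u * mon v = mon (u ++ v) := by
  simp [mon, MonoidAlgebra.single_mul_single]

/-- The sign-corrected monomial: up to the structural rules, `w` and its normal form are related by
the sign of `w`. -/
noncomputable def signedMon (w : List (Gen n)) : NCPoly n := wordSign w • mon w

/-- The coefficient of a polynomial at the sign-corrected monomial of `w`. -/
def signedCoeff (P : NCPoly n) (w : List (Gen n)) : ℚ := wordSign w * coeffAt P w

theorem signedCoeff_add (P Q : NCPoly n) (w : List (Gen n)) :
    signedCoeff (P + Q) w = signedCoeff P w + signedCoeff Q w := by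
  simp [signedCoeff, coeffAt_add, mul_add]

theorem signedCoeff_smul (c : ℚ) (P : NCPoly n) (w : List (Gen n)) :
    signedCoeff (c • P) w = c * signedCoeff P w := by
  simp only [signedCoeff, coeffAt_smul]; ring

theorem signedCoeff_signedMon (w w' : List (Gen n)) :
    signedCoeff (signedMon w) w' = if w = w' then 1 else 0 := by
  simp only [signedCoeff, signedMon, coeffAt_smul, coeffAt_mon]
  split_ifs with h
  · rw [h, mul_one, wordSign_mul_self]
  · simp

theorem signedCoeff_eq_zero {P : NCPoly n} {w : List (Gen n)} :
    signedCoeff P w = 0 ↔ coeffAt P w = 0 := by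
  have h : wordSign w ≠ 0 := fun h => by simpa [h] using wordSign_mul_self w
  simp [signedCoeff, h]

theorem Ascending.signedMon {w : List (Gen n)} (h : Ascending w) : signedMon w = mon w := by
  rw [BracketC.signedMon, h.wordSign, one_smul]

/-- The structural rules as replacements of a word by a word, disregarding signs. -/
inductive StructuralStep : List (Gen n) → List (Gen n) → Prop
  | xflip (i j : Fin n) (h : i ≠ j) : StructuralStep [.x i j h] [.x j i h.symm]
  | yflip (i j : Fin n) (h : i ≠ j) : StructuralStep [.y i j h] [.y j i h.symm]
  | swap {a b : Gen n} (h : Commute₂ a b ∨ Commute₂ b a) : StructuralStep [a, b] [b, a]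

/-- The factor `l` may be replaced by the sum of the words in `rs`, up to signs. -/
def SignedRule (l : List (Gen n)) (rs : List (List (Gen n))) : Prop :=
  (∃ l', StructuralStep l l' ∧ rs = [l']) ∨ ∃ a b, ReductionRule a b rs ∧ l = [a, b]

theorem genSign_x_flip (i j : Fin n) (h : i ≠ j) :
    genSign (.x i j h) * genSign (.x j i h.symm) = -1 := by
  rcases lt_or_gt_of_ne h with h1 | h1 <;> simp [genSign, h1, h1.not_gt]

theorem smul_signedMon_swap (a b : Gen n) :
    wordSign [a, b] • signedMon [b, a] = mon [b, a] := by
  have := wordSign_mul_self [b, a]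
  simp only [signedMon, wordSign, List.map_cons, List.map_nil, List.prod_cons, List.prod_nil,
    mul_one, smul_smul] at this ⊢
  rw [mul_comm (genSign a), this, one_smul]

theorem StructuralRule.signed {l : List (Gen n)} {r : NCPoly n} (h : StructuralRule l r) :
    ∃ l', StructuralStep l l' ∧ r = wordSign l • signedMon l' := by
  cases h with
  | xflip i j h =>
    refine ⟨_, .xflip i j h, ?_⟩
    simp [signedMon, wordSign, smul_smul, genSign_x_flip]
  | yflip i j h => exact ⟨_, .yflip i j h, by simp [signedMon, wordSign, genSign]⟩
  | @swap a b h => exact ⟨_, .swap h, (smul_signedMon_swap a b).symm⟩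

theorem StructuralStep.rule {l l' : List (Gen n)} (h : StructuralStep l l') :
    StructuralRule l (wordSign l • signedMon l') := by
  cases h with
  | xflip i j h =>
    convert StructuralRule.xflip i j h using 1
    simp [signedMon, wordSign, smul_smul, genSign_x_flip]
  | yflip i j h =>
    convert StructuralRule.yflip i j h using 1
    simp [signedMon, wordSign, genSign]
  | @swap a b h => exact smul_signedMon_swap a b ▸ .swap h

theorem BracketRule.signed {l : List (Gen n)} {r : NCPoly n} (h : BracketRule l r) :
    ∃ a b rs, ReductionRule a b rs ∧ l = [a, b] ∧
      r = wordSign l • (rs.map signedMon).sum := by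
  obtain ⟨a, b, rs, h, rfl, rfl⟩ := h
  refine ⟨a, b, rs, h, rfl, ?_⟩
  rw [h.ascending.1.wordSign, one_smul]
  congr 1
  exact List.map_congr_left fun r hr => (h.ascending.2 r hr).signedMon.symm

theorem mon_mul_signedMon_mul (u l v : List (Gen n)) :
    mon u * signedMon l * mon v = (wordSign u * wordSign v) • signedMon (u ++ l ++ v) := by
  simp only [signedMon, mul_smul_comm, smul_mul_assoc, mon_mul, smul_smul, wordSign_append]
  congr 1
  have h1 := wordSign_mul_self u
  have h2 := wordSign_mul_self v
  linear_combination (-(wordSign l)) * h1 - wordSign l * wordSign u * wordSign u * h2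

theorem mon_mul_sum_mul (u l v : List (Gen n)) (rs : List (List (Gen n))) :
    mon u * (wordSign l • (rs.map signedMon).sum) * mon v - mon (u ++ l ++ v) =
      wordSign (u ++ l ++ v) • (((rs.map fun r => u ++ r ++ v).map signedMon).sum -
        signedMon (u ++ l ++ v)) := by
  have h1 : mon (u ++ l ++ v) = wordSign (u ++ l ++ v) • signedMon (u ++ l ++ v) := by
    rw [signedMon, smul_smul, wordSign_mul_self, one_smul]
  rw [smul_sub, ← h1]
  congr 1
  rw [mul_smul_comm, smul_mul_assoc, ← List.sum_map_mul_left, ← List.sum_map_mul_right]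
  simp only [mon_mul_signedMon_mul, wordSign_append]
  rw [List.smul_sum, List.smul_sum, List.map_map, List.map_map, List.map_map]
  congr 1
  refine List.map_congr_left fun r _ => ?_
  simp only [Function.comp_apply, smul_smul]
  congr 1
  ring

/-- A rewriting step moves a part of the signed coefficient of a word to the words that result from
an application of the rule. -/
theorem Rewrites.exists_signed {R : List (Gen n) → NCPoly n → Prop}
    {S : List (Gen n) → List (List (Gen n)) → Prop}
    (hR : ∀ l r, R l r → ∃ rs, S l rs ∧ r = wordSign l • (rs.map signedMon).sum)
    {P Q : NCPoly n} (h : Rewrites R P Q) :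
    ∃ u l v rs, ∃ t : ℚ, S l rs ∧ 0 < t ∧ t ≤ 1 ∧ signedCoeff P (u ++ l ++ v) ≠ 0 ∧
      Q = P + (t * signedCoeff P (u ++ l ++ v)) •
        (((rs.map fun r => u ++ r ++ v).map signedMon).sum - signedMon (u ++ l ++ v)) := by
  obtain ⟨u, l, v, r, t, hr, h0, h1, hc, rfl⟩ := h
  obtain ⟨rs, hrs, rfl⟩ := hR l r hr
  refine ⟨u, l, v, rs, t, hrs, h0, h1, signedCoeff_eq_zero.not.2 hc, ?_⟩
  rw [mon_mul_sum_mul, smul_smul, signedCoeff]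
  congr 2
  ring

/-- All signed coefficients of `P` are nonnegative, and the words occurring in `P` satisfy `A`.
Nonnegativity excludes cancellations in the course of the rewriting. -/
def Positive (A : List (Gen n) → Prop) (P : NCPoly n) : Prop :=
  ∀ w, 0 ≤ signedCoeff P w ∧ (signedCoeff P w ≠ 0 → A w)

theorem Positive.add {A : List (Gen n) → Prop} {P Q : NCPoly n} (hP : Positive A P)
    (hQ : Positive A Q) : Positive A (P + Q) := by
  intro w
  rw [signedCoeff_add]
  refine ⟨add_nonneg (hP w).1 (hQ w).1, fun h => ?_⟩
  by_cases h1 : signedCoeff P w = 0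
  · exact (hQ w).2 fun h2 => h (by rw [h1, h2, add_zero])
  · exact (hP w).2 h1

theorem Positive.smul {A : List (Gen n) → Prop} {P : NCPoly n} (hP : Positive A P) {c : ℚ}
    (hc : 0 ≤ c) : Positive A (c • P) := by
  intro w
  rw [signedCoeff_smul]
  exact ⟨mul_nonneg hc (hP w).1, fun h => (hP w).2 (right_ne_zero_of_mul h)⟩

theorem positive_zero (A : List (Gen n) → Prop) : Positive A 0 := by
  intro w
  simp [signedCoeff, coeffAt_zero]

theorem positive_signedMon {A : List (Gen n) → Prop} {w : List (Gen n)} (hw : A w) :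
    Positive A (signedMon w) := by
  intro w'
  rw [signedCoeff_signedMon]
  split_ifs with h
  · exact ⟨zero_le_one, fun _ => h ▸ hw⟩
  · simp

theorem positive_sum {A : List (Gen n) → Prop} {L : Multiset (NCPoly n)}
    (h : ∀ P ∈ L, Positive A P) : Positive A L.sum :=
  Multiset.sum_induction _ _ (fun _ _ => Positive.add) (positive_zero A) h

theorem Positive.step {A : List (Gen n) → Prop} {P : NCPoly n} (hP : Positive A P)
    {w : List (Gen n)} {ws : List (List (Gen n))} {t : ℚ} (h0 : 0 < t) (h1 : t ≤ 1)
    (hws : ∀ w' ∈ ws, A w') :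
    Positive A (P + (t * signedCoeff P w) • ((ws.map signedMon).sum - signedMon w)) := by
  have h2 : Positive A (P + (-(t * signedCoeff P w)) • signedMon w) := by
    intro w'
    rw [signedCoeff_add, signedCoeff_smul, signedCoeff_signedMon]
    split_ifs with h
    · subst h
      have h3 := (hP w).1
      refine ⟨by nlinarith, fun h4 => (hP w).2 fun h5 => h4 (by rw [h5]; ring)⟩
    · simpa using hP w'
  have h3 : Positive A ((t * signedCoeff P w) • (ws.map signedMon).sum) := by
    refine Positive.smul ?_ (mul_nonneg h0.le (hP w).1)
    rw [← Multiset.sum_coe]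
    refine positive_sum fun Q hQ => ?_
    obtain ⟨w', hw', rfl⟩ := List.mem_map.1 (Multiset.mem_coe.1 hQ)
    exact positive_signedMon (hws w' hw')
  convert h2.add h3 using 1
  rw [smul_sub, neg_smul]
  abel

theorem StructuralRule.exists_signedRule (l : List (Gen n)) (r : NCPoly n)
    (h : StructuralRule l r) : ∃ rs, (∃ l', StructuralStep l l' ∧ rs = [l']) ∧
      r = wordSign l • (rs.map signedMon).sum := by
  obtain ⟨l', h1, h2⟩ := h.signed
  exact ⟨[l'], ⟨l', h1, rfl⟩, by simpa using h2⟩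

theorem BracketRule.exists_signedRule (l : List (Gen n)) (r : NCPoly n) (h : BracketRule l r) :
    ∃ rs, SignedRule l rs ∧ r = wordSign l • (rs.map signedMon).sum := by
  obtain ⟨a, b, rs, h1, h2, h3⟩ := h.signed
  exact ⟨rs, Or.inr ⟨a, b, h1, h2⟩, h3⟩

theorem StructuralStep.commEquiv_normalize {l l' : List (Gen n)} (h : StructuralStep l l') :
    CommEquiv (normalize l) (normalize l') := by
  cases h with
  | xflip i j h =>
    simp only [normalize, toEdge, List.map_cons, List.map_nil, min_comm, max_comm]
    exact .refl
  | yflip i j h =>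
    simp only [normalize, toEdge, List.map_cons, List.map_nil, min_comm, max_comm]
    exact .refl
  | @swap a b h =>
    exact .swap ((h.elim Commute₂.apart fun h => h.apart.symm).commute (valid_toEdge a)
      (valid_toEdge b))

theorem StructuralStep.commEquiv_normalize_append {l l' : List (Gen n)}
    (h : StructuralStep l l') (u v : List (Gen n)) :
    CommEquiv (normalize (u ++ l ++ v)) (normalize (u ++ l' ++ v)) := by
  simp only [normalize_append]
  exact h.commEquiv_normalize.append _ _

theorem SignedRule.good {l : List (Gen n)} {rs : List (List (Gen n))} (h : SignedRule l rs)
    {u v : List (Gen n)} (hg : Good ((u ++ l ++ v).map toEdge)) :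
    ∀ r ∈ rs, Good ((u ++ r ++ v).map toEdge) := by
  rcases h with ⟨l', h, rfl⟩ | ⟨a, b, h, rfl⟩
  · intro r hr
    obtain rfl := List.mem_singleton.1 hr
    rw [← normalize_map_toEdge] at hg ⊢
    exact hg.commEquiv (h.commEquiv_normalize_append u v)
  · intro r hr
    simp only [List.map_append, List.map_cons, List.map_nil] at hg ⊢
    exact hg.reduce h r hr

/-- The reduction relation between polynomials. -/
def Reduces (P Q : NCPoly n) : Prop := Rewrites StructuralRule P Q ∨ Rewrites BracketRule P Q

theorem Reduces.exists_signed {P Q : NCPoly n} (h : Reduces P Q) :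
    ∃ u l v rs, ∃ t : ℚ, SignedRule l rs ∧ 0 < t ∧ t ≤ 1 ∧ signedCoeff P (u ++ l ++ v) ≠ 0 ∧
      Q = P + (t * signedCoeff P (u ++ l ++ v)) •
        (((rs.map fun r => u ++ r ++ v).map signedMon).sum - signedMon (u ++ l ++ v)) := by
  rcases h with h | h
  · refine h.exists_signed fun l r h => ?_
    obtain ⟨rs, h1, h2⟩ := StructuralRule.exists_signedRule l r h
    exact ⟨rs, Or.inl h1, h2⟩
  · exact h.exists_signed BracketRule.exists_signedRule

/-- The words occurring in `P` are words of admissible graphs. -/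
abbrev GoodPoly (P : NCPoly n) : Prop := Positive (fun w => Good (w.map toEdge)) P

theorem GoodPoly.reduces {P Q : NCPoly n} (hP : GoodPoly P) (h : Reduces P Q) : GoodPoly Q := by
  obtain ⟨u, l, v, rs, t, hS, h0, h1, hc, rfl⟩ := h.exists_signed
  refine hP.step h0 h1 fun w' hw' => ?_
  obtain ⟨r, hr, rfl⟩ := List.mem_map.1 hw'
  exact hS.good ((hP _).2 hc) r hr

theorem GoodPoly.of_reflTransGen {P Q : NCPoly n} (hP : GoodPoly P)
    (h : Relation.ReflTransGen Reduces P Q) : GoodPoly Q := by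
  induction h with
  | refl => exact hP
  | tail _ h ih => exact ih.reduces h

/-! ### Linear functionals on polynomials -/

/-- The linear map sending the sign-corrected monomial of `w` to `f w`. -/
noncomputable def evalSigned {M : Type*} [AddCommGroup M] [Module ℚ M]
    (f : List (Gen n) → M) : NCPoly n →ₗ[ℚ] M :=
  Finsupp.linearCombination ℚ (fun w : FreeMonoid (Gen n) => wordSign w.toList • f w.toList) ∘ₗ
    (MonoidAlgebra.coeffLinearEquiv ℚ).toLinearMap

variable {M : Type*} [AddCommGroup M] [Module ℚ M]

theorem evalSigned_apply (f : List (Gen n) → M) (P : NCPoly n) :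
    evalSigned f P = ∑ w ∈ P.coeff.support, signedCoeff P w.toList • f w.toList := by
  simp only [evalSigned, LinearMap.comp_apply, Finsupp.linearCombination_apply, Finsupp.sum]
  refine Finset.sum_congr rfl fun w _ => ?_
  rw [smul_smul, signedCoeff, mul_comm]
  rfl

theorem evalSigned_mon (f : List (Gen n) → M) (w : List (Gen n)) :
    evalSigned f (mon w) = wordSign w • f w := by
  simp only [evalSigned, LinearMap.comp_apply, mon]
  exact (Finsupp.linearCombination_single ..).trans (one_smul ..)

theorem evalSigned_signedMon (f : List (Gen n) → M) (w : List (Gen n)) :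
    evalSigned f (signedMon w) = f w := by
  rw [signedMon, map_smul, evalSigned_mon, smul_smul, wordSign_mul_self, one_smul]

theorem eq_evalSigned (F : NCPoly n →ₗ[ℚ] M) (P : NCPoly n) :
    F P = evalSigned (fun w => F (signedMon w)) P := by
  have : F = evalSigned (fun w => F (signedMon w)) := by
    refine MonoidAlgebra.lhom_ext' fun w => LinearMap.ext_ring ?_
    have h := evalSigned_mon (fun w => F (signedMon w)) (FreeMonoid.toList w)
    rw [← map_smul, signedMon, smul_smul, wordSign_mul_self, one_smul] at h
    exact h.symm
  exact congrArg (· P) this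

/-- A function on admissible words that is compatible with the rules gives a functional that is
invariant under rewriting. -/
theorem evalSigned_reduces {f : List (Gen n) → M} {P Q : NCPoly n} (hP : GoodPoly P)
    (hf : ∀ u l v rs, SignedRule l rs → Good ((u ++ l ++ v).map toEdge) →
      (rs.map fun r => f (u ++ r ++ v)).sum = f (u ++ l ++ v))
    (h : Reduces P Q) : evalSigned f Q = evalSigned f P := by
  obtain ⟨u, l, v, rs, t, hS, h0, h1, hc, rfl⟩ := h.exists_signed
  rw [map_add, map_smul, map_sub, map_list_sum, List.map_map, List.map_map]
  have h2 : (rs.map ((evalSigned f ∘ signedMon) ∘ fun r => u ++ r ++ v)).sum =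
      evalSigned f (signedMon (u ++ l ++ v)) := by
    rw [evalSigned_signedMon, ← hf u l v rs hS ((hP _).2 hc)]
    congr 1
    exact List.map_congr_left fun r _ => evalSigned_signedMon f _
  rw [h2, sub_self, smul_zero, add_zero]

theorem evalSigned_reflTransGen {f : List (Gen n) → M} {P Q : NCPoly n} (hP : GoodPoly P)
    (hf : ∀ u l v rs, SignedRule l rs → Good ((u ++ l ++ v).map toEdge) →
      (rs.map fun r => f (u ++ r ++ v)).sum = f (u ++ l ++ v))
    (h : Relation.ReflTransGen Reduces P Q) : evalSigned f Q = evalSigned f P := by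
  induction h with
  | refl => rfl
  | tail h1 h2 ih => rw [evalSigned_reduces (hP.of_reflTransGen h1) hf h2, ih]

theorem SignedRule.sum_ind_cone {p : Fin n → ℝ} (hp : Generic p) (u l v : List (Gen n))
    (rs : List (List (Gen n))) (h : SignedRule l rs) (hg : Good ((u ++ l ++ v).map toEdge)) :
    (rs.map fun r => (ind (p ∈ cone ((u ++ r ++ v).map toEdge)) : ℚ)).sum =
      ind (p ∈ cone ((u ++ l ++ v).map toEdge)) := by
  rcases h with ⟨l', h, rfl⟩ | ⟨a, b, h, rfl⟩
  · simp only [List.map_cons, List.map_nil, List.sum_singleton]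
    rw [← normalize_map_toEdge, ← normalize_map_toEdge (u ++ l ++ v),
      cone_perm ((h.commEquiv_normalize_append u v).perm.map toEdge)]
  · have h1 := hp.ind_cone_reduce (u := u.map toEdge) (v := v.map toEdge)
      (by simpa using hg.length) h
    simp only [List.map_append, List.map_cons, List.map_nil] at h1 ⊢
    rw [← h1, Nat.cast_list_sum, List.map_map]
    rfl

/-! ### Polynomials up to commutations -/

theorem upToComm_rel {l : List (Gen n)} {r : NCPoly n} (h : StructuralRule l r) :
    upToComm (mon l) = upToComm r := by
  unfold upToComm
  exact RingQuot.mkAlgHom_rel ℚ ⟨l, rfl, h⟩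

theorem upToComm_mon_append (u l v : List (Gen n)) :
    upToComm (mon (u ++ l ++ v)) = upToComm (mon u) * upToComm (mon l) * upToComm (mon v) := by
  rw [← map_mul, ← map_mul, mon_mul, mon_mul]

theorem CommEquiv.upToComm_eq {w w' : List (Gen n)} (h : CommEquiv w w') :
    upToComm (mon w) = upToComm (mon w') := by
  induction h with
  | refl => rfl
  | tail _ h ih =>
    obtain ⟨u, a, b, v, hab, rfl, rfl⟩ := h
    rw [ih, upToComm_mon_append, upToComm_mon_append, upToComm_rel (.swap hab)]

theorem upToComm_signedMon (w : List (Gen n)) :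
    upToComm (signedMon w) = upToComm (mon (normalize w)) := by
  induction w with
  | nil => simp [signedMon, wordSign, normalize]
  | cons g w ih =>
    have h1 : signedMon (g :: w) = signedMon [g] * signedMon w := by
      simp only [signedMon, mul_smul_comm, smul_mul_assoc, mon_mul, smul_smul]
      simp [wordSign, mul_comm]
    have h2 : upToComm (signedMon [g]) = upToComm (mon (normalize [g])) := by
      by_cases hg : edgeVar (toEdge g) = g
      · have h3 : Ascending [g] := by simpa [Ascending] using hg
        rw [h3.signedMon, h3.normalize]
      · have h3 : ∃ l', StructuralStep [g] l' ∧ Ascending l' := by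
          cases g with
          | x i j h =>
            have hji : j < i := (lt_or_gt_of_ne h).resolve_left fun h1 =>
              hg (by simp [toEdge, edgeVar, h1.le, h1.ne])
            exact ⟨_, .xflip i j h, by simp [Ascending, toEdge, edgeVar, hji.le, hji.ne]⟩
          | y i j h =>
            have hji : j < i := (lt_or_gt_of_ne h).resolve_left fun h1 =>
              hg (by simp [toEdge, edgeVar, h1.le, h1.ne])
            exact ⟨_, .yflip i j h, by simp [Ascending, toEdge, edgeVar, hji.le, hji.ne]⟩
          | z i => exact absurd (by simp [toEdge, edgeVar]) hg
        obtain ⟨l', h3, h4⟩ := h3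
        rw [signedMon, map_smul, upToComm_rel h3.rule, map_smul, smul_smul, wordSign_mul_self,
          one_smul, h4.signedMon, h3.commEquiv_normalize.upToComm_eq, h4.normalize]
    rw [h1, map_mul, h2, ih, ← map_mul, mon_mul, ← normalize_append]
    rfl

/-! ### Words of irreducible polynomials -/

/-- A structural rule applied to a factor of a word, disregarding signs. -/
def StructuralMove (w w' : List (Gen n)) : Prop :=
  ∃ u l v l', StructuralStep l l' ∧ w = u ++ l ++ v ∧ w' = u ++ l' ++ v

theorem StructuralMove.append {w w' : List (Gen n)} (h : StructuralMove w w')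
    (u v : List (Gen n)) : StructuralMove (u ++ w ++ v) (u ++ w' ++ v) := by
  obtain ⟨u', l, v', l', h, rfl, rfl⟩ := h
  exact ⟨u ++ u', l, v' ++ v, l', h, by simp, by simp⟩

theorem exists_move_letter (g : Gen n) :
    edgeVar (toEdge g) = g ∨ StructuralMove [g] [edgeVar (toEdge g)] := by
  cases g with
  | x i j h =>
    rcases lt_or_gt_of_ne h with h1 | h1
    · left; simp [toEdge, edgeVar, h1.le, h1.ne]
    · right
      exact ⟨[], _, [], _, .xflip i j h, rfl, by simp [toEdge, edgeVar, h1.le, h1.ne]⟩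
  | y i j h =>
    rcases lt_or_gt_of_ne h with h1 | h1
    · left; simp [toEdge, edgeVar, h1.le, h1.ne]
    · right
      exact ⟨[], _, [], _, .yflip i j h, rfl, by simp [toEdge, edgeVar, h1.le, h1.ne]⟩
  | z i => left; simp [toEdge, edgeVar]

theorem moves_normalize (w : List (Gen n)) :
    Relation.ReflTransGen StructuralMove w (normalize w) := by
  induction w with
  | nil => exact .refl
  | cons g w ih =>
    have h1 : Relation.ReflTransGen StructuralMove (g :: w) (g :: normalize w) :=
      ih.lift (g :: ·) fun a b hab => by simpa using hab.append [g] []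
    have h2 : normalize (g :: w) = edgeVar (toEdge g) :: normalize w := rfl
    rcases exists_move_letter g with h | h
    · rwa [h2, h]
    · exact h1.tail (by simpa [h2] using h.append [] (normalize w))

theorem SwapStep.move {w w' : List (Gen n)} (h : SwapStep w w') : StructuralMove w w' := by
  obtain ⟨u, a, b, v, h, rfl, rfl⟩ := h
  exact ⟨u, _, v, _, .swap h, rfl, rfl⟩

/-- A word occurring in a polynomial without cancellations can be moved as a whole. -/
theorem Positive.exists_move {P : NCPoly n} (hP : Positive (fun _ => True) P)
    {w w' : List (Gen n)} (hw : signedCoeff P w ≠ 0) (h : StructuralMove w w') :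
    ∃ Q, Rewrites StructuralRule P Q ∧ Positive (fun _ => True) Q ∧ signedCoeff Q w' ≠ 0 := by
  obtain ⟨u, l, v, l', h, rfl, rfl⟩ := h
  refine ⟨P + (1 * signedCoeff P (u ++ l ++ v)) •
      (([u ++ l' ++ v].map signedMon).sum - signedMon (u ++ l ++ v)),
    ⟨u, l, v, _, 1, h.rule, one_pos, le_rfl, signedCoeff_eq_zero.not.1 hw, ?_⟩,
    hP.step one_pos le_rfl (by simp), ?_⟩
  · have h1 := mon_mul_sum_mul u l v [l']
    simp only [List.map_cons, List.map_nil, List.sum_singleton] at h1 ⊢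
    rw [h1, smul_smul, signedCoeff]
    congr 2
    ring
  · have h1 := (hP (u ++ l ++ v)).1
    have h2 := (hP (u ++ l' ++ v)).1
    have h3 := lt_of_le_of_ne h1 (Ne.symm hw)
    rw [sub_eq_add_neg, ← neg_one_smul ℚ (signedMon (u ++ l ++ v))]
    simp only [List.map_cons, List.map_nil, List.sum_singleton, signedCoeff_add,
      signedCoeff_smul, signedCoeff_signedMon, if_true]
    split_ifs with h4
    · rw [← h4]
      linarith
    · linarith

theorem Positive.exists_moves {P : NCPoly n} (hP : Positive (fun _ => True) P)
    {w w' : List (Gen n)} (hw : signedCoeff P w ≠ 0)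
    (h : Relation.ReflTransGen StructuralMove w w') :
    ∃ Q, Relation.ReflTransGen (Rewrites StructuralRule) P Q ∧ Positive (fun _ => True) Q ∧
      signedCoeff Q w' ≠ 0 := by
  induction h with
  | refl => exact ⟨P, .refl, hP, hw⟩
  | tail _ h ih =>
    obtain ⟨Q, h1, h2, h3⟩ := ih
    obtain ⟨Q', h4, h5, h6⟩ := h2.exists_move h3 h
    exact ⟨Q', h1.tail h4, h5, h6⟩

theorem Positive.irredWord {P : NCPoly n} (hP : Positive (fun _ => True) P)
    (hirr : IsIrreducible P) {w : List (Gen n)} (hw : signedCoeff P w ≠ 0) :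
    IrredWord (normalize w) := by
  intro u a b v rs hc hr
  have h1 : Relation.ReflTransGen StructuralMove w (u ++ [a, b] ++ v) :=
    (moves_normalize w).trans (Relation.ReflTransGen.mono (fun _ _ => SwapStep.move) _ _ hc)
  obtain ⟨Q, h2, -, h3⟩ := hP.exists_moves hw h1
  exact hirr Q h2 _ ⟨u, [a, b], v, _, 1, ⟨a, b, rs, hr, rfl, rfl⟩, one_pos, le_rfl,
    signedCoeff_eq_zero.not.1 h3, rfl⟩

/-! ### Reduced forms -/

/-- If `R` has nonnegative coefficients, then in `R + w` the term `w` can be rewritten separately: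
this is the part `1 / (r + 1)` of the term of the word `w`, where `r` is the coefficient in `R`. -/
theorem rewrites_add_mon {S : List (Gen n) → NCPoly n → Prop} {R : NCPoly n}
    (hR : ∀ w, 0 ≤ coeffAt R w) (u l v : List (Gen n)) {r : NCPoly n} (h : S l r) :
    Rewrites S (R + mon (u ++ l ++ v)) (R + mon u * r * mon v) := by
  have h1 := hR (u ++ l ++ v)
  have h2 : coeffAt (R + mon (u ++ l ++ v)) (u ++ l ++ v) = coeffAt R (u ++ l ++ v) + 1 := by
    rw [coeffAt_add, coeffAt_mon, if_pos rfl]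
  have h3 : 0 < coeffAt R (u ++ l ++ v) + 1 := by linarith
  refine ⟨u, l, v, r, 1 / (coeffAt R (u ++ l ++ v) + 1), h, by positivity, ?_, ?_, ?_⟩
  · rw [div_le_one h3]
    linarith
  · rw [h2]
    exact h3.ne'
  · rw [h2, div_mul_cancel₀ _ h3.ne', one_smul]
    abel

theorem commEquiv_reduces {R : NCPoly n} (hR : ∀ w, 0 ≤ coeffAt R w) {w w' : List (Gen n)}
    (h : CommEquiv w w') : Relation.ReflTransGen Reduces (R + mon w) (R + mon w') := by
  induction h with
  | refl => exact .refl
  | tail _ h ih =>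
    obtain ⟨u, a, b, v, hab, rfl, rfl⟩ := h
    refine ih.tail (Or.inl ?_)
    have := rewrites_add_mon hR u [a, b] v (StructuralRule.swap hab)
    rwa [mon_mul, mon_mul] at this

theorem coeffAt_sum_nonneg (L : Multiset (List (Gen n))) (w : List (Gen n)) :
    0 ≤ coeffAt (L.map mon).sum w := by
  induction L using Multiset.induction with
  | empty => simp [coeffAt_zero]
  | cons a L ih =>
    rw [Multiset.map_cons, Multiset.sum_cons, coeffAt_add, coeffAt_mon]
    split_ifs <;> linarith

theorem HasLeaves.reduces {w : List (Gen n)} {L : Multiset (List (Gen n))} (h : HasLeaves w L) :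
    ∀ R : NCPoly n, (∀ w, 0 ≤ coeffAt R w) →
      Relation.ReflTransGen Reduces (R + mon w) (R + (L.map mon).sum) := by
  induction h with
  | leaf w h => intro R _; simpa using .refl
  | node w u v a b rs L hwc hr hL ih =>
    intro R hR
    refine (commEquiv_reduces hR hwc).trans (.head (Or.inr (rewrites_add_mon hR u [a, b] v
      ⟨a, b, rs, hr, rfl, rfl⟩)) ?_)
    have h1 : mon u * (rs.map mon).sum * mon v = (rs.map fun r => mon (u ++ r ++ v)).sum := by
      rw [← List.sum_map_mul_left, ← List.sum_map_mul_right]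
      simp only [mon_mul]
    rw [h1]
    clear h1 hr hL
    induction rs generalizing R with
    | nil => simpa using .refl
    | cons r rs ihr =>
      have h2 : ∀ w, 0 ≤ coeffAt (R + (rs.map fun r => mon (u ++ r ++ v)).sum) w := fun w => by
        have := coeffAt_sum_nonneg (↑(rs.map fun r => u ++ r ++ v)) w
        rw [coeffAt_add]
        refine add_nonneg (hR w) ?_
        simpa [Function.comp_def] using this
      have h3 : ∀ w, 0 ≤ coeffAt (R + ((L r).map mon).sum) w := fun w => by
        rw [coeffAt_add]
        exact add_nonneg (hR w) (coeffAt_sum_nonneg _ w)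
      have h4 := ih r (by simp) _ h2
      have h5 := ihr (fun r hr => ih r (by simp [hr])) _ h3
      rw [List.map_cons, List.sum_cons, List.map_cons, List.sum_cons, Multiset.map_add,
        Multiset.sum_add, ← add_assoc, ← add_assoc]
      rw [add_right_comm, add_right_comm R (List.sum _)] at h4
      exact h4.trans h5

/-- The sum of the leaves of a reduction tree is irreducible: structural rules replace a leaf by
words with an equivalent normal form. -/
theorem isIrreducible_sum {L : Multiset (List (Gen n))}
    (hL : ∀ l ∈ L, Ascending l ∧ IrredWord l) : IsIrreducible (L.map mon).sum := by
  have h0 : Positive (fun w => ∃ l ∈ L, CommEquiv l (normalize w)) (L.map mon).sum := by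
    refine positive_sum fun P hP => ?_
    obtain ⟨l, hl, rfl⟩ := Multiset.mem_map.1 hP
    rw [← (hL l hl).1.signedMon]
    exact positive_signedMon ⟨l, hl, by rw [(hL l hl).1.normalize]; exact .refl⟩
  intro Q hQ
  have h1 : Positive (fun w => ∃ l ∈ L, CommEquiv l (normalize w)) Q := by
    induction hQ with
    | refl => exact h0
    | tail _ h ih =>
      obtain ⟨u, l, v, rs, t, ⟨l', hl', rfl⟩, h0, h1, hc, rfl⟩ :=
        h.exists_signed StructuralRule.exists_signedRule
      refine ih.step h0 h1 fun w' hw' => ?_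
      obtain ⟨m, hm, hc⟩ := (ih _).2 hc
      obtain rfl : w' = u ++ l' ++ v := by simpa using hw'
      exact ⟨m, hm, hc.trans (hl'.commEquiv_normalize_append u v)⟩
  rintro Q' ⟨u, l, v, r, t, ⟨a, b, rs, hr, rfl, rfl⟩, -, -, hc, -⟩
  obtain ⟨l, hl, h2⟩ := (h1 _).2 (signedCoeff_eq_zero.not.2 hc)
  rw [normalize_append, normalize_append, hr.ascending.1.normalize] at h2
  exact (hL l hl).2 _ a b _ rs h2 hr

theorem exists_isReducedForm (hn : 1 ≤ n) : ∃ P, IsReducedForm (coxeterWord n hn) P := by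
  obtain ⟨L, hL⟩ := exists_hasLeaves (coxeterWord n hn)
  refine ⟨(L.map mon).sum, ?_, isIrreducible_sum fun l hl =>
    (hL.leaf_properties (good_coxeterWord hn) (ascending_coxeterWord hn) l hl).2⟩
  have h := hL.reduces 0 fun w => (coeffAt_zero w).ge
  rwa [zero_add, zero_add] at h

/-- The coefficient of a graph `G` in the reduced form is the value of an invariant functional: the
sum of the coefficients of the words whose cone contains a generic point of the cone of `G`. -/
theorem upToComm_eq_of_isReducedForm {hn : 1 ≤ n} {P : NCPoly n}
    (h : IsReducedForm (coxeterWord n hn) P) :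
    upToComm P = ∑ G ∈ altWellStructured n, upToComm (mon (lexWord G)) := by
  obtain ⟨hred, hirr⟩ := h
  have hw₀ := ascending_coxeterWord hn
  have hgood₀ : GoodPoly (mon (coxeterWord n hn)) :=
    hw₀.signedMon ▸ positive_signedMon (good_coxeterWord hn)
  have hP : GoodPoly P := hgood₀.of_reflTransGen hred
  have hsupp : ∀ w ∈ P.coeff.support, Good ((normalize w.toList).map toEdge) ∧
      IrredWord (normalize w.toList) := by
    intro w hw
    have h1 : signedCoeff P w.toList ≠ 0 :=
      signedCoeff_eq_zero.not.2 (Finsupp.mem_support_iff.1 hw)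
    exact ⟨by rw [normalize_map_toEdge]; exact (hP _).2 h1,
      Positive.irredWord (fun w => ⟨(hP w).1, fun _ => trivial⟩) hirr h1⟩
  let graph : FreeMonoid (Gen n) → Finset (Edge n) :=
    fun w => ((normalize w.toList).map toEdge).toFinset
  have hgraph : ∀ w ∈ P.coeff.support, graph w ∈ altWellStructured n := fun w hw =>
    (hsupp w hw).1.mem_altWellStructured (ascending_normalize _) (hsupp w hw).2
  have h1 : upToComm P =
      ∑ w ∈ P.coeff.support, signedCoeff P w.toList • upToComm (mon (lexWord (graph w))) := by
    have h2 := eq_evalSigned (upToComm (n := n)).toLinearMap P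
    rw [evalSigned_apply] at h2
    refine h2.trans (Finset.sum_congr rfl fun w hw => ?_)
    obtain ⟨h3, h4⟩ := hsupp w hw
    have h5 := ascending_normalize w.toList
    congr 1
    exact (upToComm_signedMon _).trans
      (h3.commEquiv_lexWord h5 (h3.alternating h5 h4)).upToComm_eq
  have h2 : ∀ G ∈ altWellStructured n,
      ∑ w ∈ P.coeff.support with graph w = G, signedCoeff P w.toList = 1 := by
    intro G hG
    obtain ⟨p, c, hgen, hp, hc⟩ := exists_generic_flow hG
    have h3 := evalSigned_reflTransGen (f := fun w => (ind (p ∈ cone (w.map toEdge)) : ℚ))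
      hgood₀ (SignedRule.sum_ind_cone hgen) hred
    rw [evalSigned_mon, hw₀.wordSign, ind_eq_one (hc.mem_cone_coxeterWord hgen hp hn),
      evalSigned_apply] at h3
    rw [Finset.sum_filter]
    simp only [Nat.cast_one, smul_eq_mul, mul_one] at h3
    rw [← h3]
    refine Finset.sum_congr rfl fun w hw => ?_
    have h4 := mem_cone_iff_toFinset_eq hG hp hc (hsupp w hw).1 (ascending_normalize _)
      (hsupp w hw).2
    rw [normalize_map_toEdge] at h4
    by_cases h5 : graph w = G
    · have h6 : p ∈ cone (w.toList.map toEdge) :=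
        h4.2 (by rw [← normalize_map_toEdge]; exact h5)
      rw [if_pos h5, ind_eq_one h6, Nat.cast_one, mul_one]
    · have h6 : p ∉ cone (w.toList.map toEdge) := fun h7 => h5 (by
        simp only [graph]
        rw [normalize_map_toEdge]
        exact h4.1 h7)
      rw [if_neg h5, ind_eq_zero h6, Nat.cast_zero, mul_zero]
  rw [h1, ← Finset.sum_fiberwise_of_maps_to hgraph]
  refine Finset.sum_congr rfl fun G hG => ?_
  rw [Finset.sum_congr rfl fun w hw => by rw [(Finset.mem_filter.1 hw).2], ← Finset.sum_smul,
    h2 G hG, one_smul]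

end BracketC

theorem theorem9p3 (n : ℕ) (hn : 1 ≤ n) :
    -- reduced forms exist
    (∃ P, BracketC.IsReducedForm (BracketC.coxeterWord n hn) P) ∧
    -- every reduced form is, up to commutations, the stated sum
    (∀ P, BracketC.IsReducedForm (BracketC.coxeterWord n hn) P →
      BracketC.upToComm P =
        ∑ G ∈ BracketC.altWellStructured n,
          BracketC.upToComm (BracketC.mon (BracketC.lexWord G))) ∧
    -- in particular it does not depend on the order of reductions
    (∀ P Q, BracketC.IsReducedForm (BracketC.coxeterWord n hn) P →
      BracketC.IsReducedForm (BracketC.coxeterWord n hn) Q →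
      BracketC.upToComm P = BracketC.upToComm Q) ∧
    -- reduction trees exist
    (∃ L, BracketC.HasLeaves (BracketC.coxeterWord n hn) L) ∧
    -- the leaves of any reduction tree are, up to commutations, the alternating well-structured
    -- graphs with lexicographic edge-labels, each occurring exactly once
    (∀ L, BracketC.HasLeaves (BracketC.coxeterWord n hn) L →
      Multiset.Rel BracketC.CommEquiv L
        ((BracketC.altWellStructured n).val.map BracketC.lexWord)) :=
  ⟨BracketC.exists_isReducedForm hn,
    fun _ hP => BracketC.upToComm_eq_of_isReducedForm hP,
    fun _ _ hP hQ => (BracketC.upToComm_eq_of_isReducedForm hP).trans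
      (BracketC.upToComm_eq_of_isReducedForm hQ).symm,
    BracketC.exists_hasLeaves _,
    fun _ hL => hL.rel⟩
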